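/- Let $n\ge 1$, $\beta,\gamma>0$, and let $\Omega=B(0,1)$ be the open unit ball of $\mathbf R^n$. For $r\ge 1$ put $$\Gamma(r)=\begin{cases} r-1 & n=1,\\ \ln r & n=2,\\ \frac1{n-2}\left(1-r^{2-n}\right) & n\ge 3,\end{cases}\qquad \delta(r)=\frac{1}{1+\beta r^{n-1}\Gamma(r)} .$$ **Theorem.** Assume that $\beta\ge n-\tfrac12$ and that $R\ge1$ satisfies $$\left(\beta^2-\frac{\beta(n-1)}{R}\right)\delta(R)^2=\gamma^2 .$$ Then the function $u\colon\mathbf R^n\to\mathbf R$ defined by $$u(x)=\begin{cases}1 & |x|\le 1,\\ 1-\beta\,\delta(R)\,R^{n-1}\,\Gamma(|x|) & 1\le|x|\le R,\\ 0 & |x|>R,\end{cases}$$ is calibrated. Here a function $u\colon\mathbf R^n\to\mathbf R$ is *calibrated* (with respect to $\Omega,\beta,\gamma$) if $u\in SBV(\mathbf R^n)$, $u=1$ on $\Omega$, $0\le u\le1$, $u$ has compact support, and there exists a Borel map $\phi=(\phi^x,\phi^t)\colon(\mathbf R^n\setminus\Omega)\times\mathbf R\to\mathbf R^n\times\mathbf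 R$ which is bounded and approximately regular in $(\mathbf R^n\setminus\Omega)\times[0,1]$, divergence-free in the sense of distributions in $(\mathbf R^n\setminus\overline\Omega)\times\,]0,1[$, and such that - (a) $\phi^t(x,t)\ge\frac14|\phi^x(x,t)|^2-\gamma^2\mathbf 1_{]0,1]}(t)$ for $\mathcal L^n$-a.e. $x\in\mathbf R^n\setminus\overline\Omega$ and every $t\in[0,1]$; - (b) for $\mathcal H^{n-1}$-a.e. $x\in\mathbf R^n\setminus\Omega$ and every $r<s$, the function $\phi^x(x,\cdot)$ is integrable on $[r,s]$ and $\left|\int_r^s\phi^x(x,t)\,dt\right|\le\beta(r^2+s^2)$; - (a') $\phi^x(x,u)=2\nabla u$ and $\phi^t(x,u)=|\nabla u|^2-\gamma^2\mathbf 1_{]0,1]}(u)$ for $\mathcal L^n$-a.e. $x\in\mathbf R^n\setminus\overline\Omega$; - (b') $\int_{u^-}^{u^+}\phi^x(x,t)\,dt=\beta\left[(u^-)^2+(u^+)^2\right]\nu_u$ for $\mathcal H^{n-1}$-a.e. $x\in J_u$. In this definition $\nabla u$ is the density of the absolutely continuous part of $Du$. The jump set $J_u$ is the set of points $x$ for which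 there are reals $u^-<u^+$ and a unit vector $\nu_u$ (pointing from the $u^-$ side to the $u^+$ side) such that the mean values of $|u-u^+|$ over $B_r(x)\cap\{y:(y-x)\cdot\nu_u>0\}$ and of $|u-u^-|$ over $B_r(x)\cap\{y:(y-x)\cdot\nu_u<0\}$ tend to $0$ as $r\to0$. A map $\phi$ is *approximately regular in $D$* if for every Lipschitz hypersurface $M$ of $\mathbf R^n\times\mathbf R$ with unit normal $\nu_M$, for $\mathcal H^n$-a.e. $p\in M\cap D$, the mean value of $|\phi(q)\cdot\nu_M(p)-\phi(p)\cdot\nu_M(p)|$ over $q\in B_r(p)\cap D$ tends to $0$ as $r\to0$. -/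

import Mathlib

open MeasureTheory Filter Set Metric
open scoped Topology NNReal ContDiff

noncomputable section

namespace ThermalInsulation

/-- `x` is a jump point of `u` with one-sided approximate limits `a = u⁻ < b = u⁺` and unit
normal `ν`, oriented from the side of the smaller value `a` to the side of the larger value `b`. -/
def IsJump {n : ℕ} (u : EuclideanSpace ℝ (Fin n) → ℝ) (x : EuclideanSpace ℝ (Fin n))
    (a b : ℝ) (ν : EuclideanSpace ℝ (Fin n)) : Prop :=
  a < b ∧ ‖ν‖ = 1 ∧
  Tendsto (fun r : ℝ => ⨍ y in ball x r ∩ {y | 0 < inner ℝ (y - x) ν}, |u y - b|) (𝓝[>] 0) (𝓝 0) ∧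
  Tendsto (fun r : ℝ => ⨍ y in ball x r ∩ {y | inner ℝ (y - x) ν < 0}, |u y - a|) (𝓝[>] 0) (𝓝 0)

/-- The jump set `J_u`. -/
def jumpSet {n : ℕ} (u : EuclideanSpace ℝ (Fin n) → ℝ) : Set (EuclideanSpace ℝ (Fin n)) :=
  {x | ∃ a b ν, IsJump u x a b ν}

/-- `u ∈ SBV(ℝⁿ)` and `∇u = g` almost everywhere: `u` is integrable and its distributional
derivative is a finite vector measure `Du = g 𝓛ⁿ + s σ`, where `g` is integrable and the
singular part `s σ` is concentrated on the (Lebesgue-null) jump set `J_u`, i.e. there is no Cantor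
part.  In particular `g`, the density of the absolutely continuous part of `Du`, is unique
almost everywhere. -/
def IsSBVWithGradient {n : ℕ} (u : EuclideanSpace ℝ (Fin n) → ℝ)
    (g : EuclideanSpace ℝ (Fin n) → EuclideanSpace ℝ (Fin n)) : Prop :=
  Integrable u ∧ Integrable g ∧
  ∃ (σ : Measure (EuclideanSpace ℝ (Fin n)))
    (s : EuclideanSpace ℝ (Fin n) → EuclideanSpace ℝ (Fin n)),
    IsFiniteMeasure σ ∧ Integrable s σ ∧ σ (jumpSet u)ᶜ = 0 ∧
    ∀ ψ : EuclideanSpace ℝ (Fin n) → ℝ, ContDiff ℝ ∞ ψ → HasCompactSupport ψ →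
      ∀ v : EuclideanSpace ℝ (Fin n),
        ∫ x, u x * fderiv ℝ ψ x v =
          -((∫ x, ψ x * inner ℝ (g x) v) + (∫ x, ψ x * inner ℝ (s x) v ∂σ))

/-- The Euclidean scalar product of `ℝⁿ × ℝ`.  (The norm that Lean puts on the product type is the
equivalent maximum norm; it is used below only through notions which do not distinguish between
equivalent norms: open sets, Lipschitz maps, `o(·)`, Hausdorff-null sets, averages tending
to zero.) -/
def dot {n : ℕ} (p q : EuclideanSpace ℝ (Fin n) × ℝ) : ℝ := inner ℝ p.1 q.1 + p.2 * q.2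

/-- `M ⊆ ℝⁿ × ℝ` is a Lipschitz hypersurface: near each of its points it is the graph, in some
unit direction `e`, of a Lipschitz function over the hyperplane orthogonal to `e`. -/
def IsLipschitzHypersurface {n : ℕ} (M : Set (EuclideanSpace ℝ (Fin n) × ℝ)) : Prop :=
  ∀ p ∈ M, ∃ (e : EuclideanSpace ℝ (Fin n) × ℝ) (K : ℝ≥0)
    (f : EuclideanSpace ℝ (Fin n) × ℝ → ℝ) (U : Set (EuclideanSpace ℝ (Fin n) × ℝ)),
    dot e e = 1 ∧ LipschitzWith K f ∧ IsOpen U ∧ p ∈ U ∧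
    ∀ q ∈ U, (q ∈ M ↔ dot q e = f (q - dot q e • e))

/-- `ν` is a unit normal vector to `M` at `p`: the tangent cone of `M` at `p` is orthogonal to `ν`.
For a Lipschitz graph such a `ν` exists exactly where the graph function is differentiable
(hence almost everywhere), and it is then unique up to its sign. -/
def IsUnitNormalAt {n : ℕ} (M : Set (EuclideanSpace ℝ (Fin n) × ℝ))
    (p ν : EuclideanSpace ℝ (Fin n) × ℝ) : Prop :=
  dot ν ν = 1 ∧ (fun q => dot (q - p) ν) =o[𝓝[M] p] (fun q => q - p)

/-- `φ` is bounded and approximately regular in `D`: for every Lipschitz hypersurface `M`, at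
`ℋⁿ`-almost every point `p` of `M ∩ D`, the normal component `φ · ν_M(p)` has at `p`, relatively
to `D`, the approximate limit `φ(p) · ν_M(p)`. -/
def IsBoundedApproxRegular {n : ℕ} (D : Set (EuclideanSpace ℝ (Fin n) × ℝ))
    (φ : EuclideanSpace ℝ (Fin n) × ℝ → EuclideanSpace ℝ (Fin n) × ℝ) : Prop :=
  (∃ C : ℝ, ∀ p ∈ D, ‖φ p‖ ≤ C) ∧
  ∀ M : Set (EuclideanSpace ℝ (Fin n) × ℝ), IsLipschitzHypersurface M →
    ∀ᵐ p ∂(Measure.hausdorffMeasure (n : ℝ) : Measure (EuclideanSpace ℝ (Fin n) × ℝ)),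
      p ∈ M ∩ D → ∀ ν, IsUnitNormalAt M p ν →
        Tendsto (fun r : ℝ => ⨍ q in ball p r ∩ D, |dot (φ q) ν - dot (φ p) ν|)
          (𝓝[>] 0) (𝓝 0)

/-- `φ` is divergence-free in the open set `W`, in the sense of distributions
(`fderiv ℝ ψ p (φ p)` is `φ · ∇ψ` at `p`). -/
def IsDivFree {n : ℕ} (W : Set (EuclideanSpace ℝ (Fin n) × ℝ))
    (φ : EuclideanSpace ℝ (Fin n) × ℝ → EuclideanSpace ℝ (Fin n) × ℝ) : Prop :=
  ∀ ψ : EuclideanSpace ℝ (Fin n) × ℝ → ℝ, ContDiff ℝ ∞ ψ → HasCompactSupport ψ →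
    tsupport ψ ⊆ W → ∫ p in W, fderiv ℝ ψ p (φ p) = 0

/-- `φ = (φˣ, φᵗ)`, a map on `(ℝⁿ ∖ Ω) × ℝ`, is a calibration for the function `u` with (SBV)
gradient `g`.  Only the values of `φ` on `(ℝⁿ ∖ Ω) × ℝ` matter. -/
structure IsCalibration {n : ℕ} (Ω : Set (EuclideanSpace ℝ (Fin n))) (β γ : ℝ)
    (u : EuclideanSpace ℝ (Fin n) → ℝ)
    (g : EuclideanSpace ℝ (Fin n) → EuclideanSpace ℝ (Fin n))
    (φ : EuclideanSpace ℝ (Fin n) × ℝ → EuclideanSpace ℝ (Fin n) × ℝ) : Prop where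
  borel : Measurable (fun p : ↥(Ωᶜ ×ˢ (univ : Set ℝ)) => φ p)
  regular : IsBoundedApproxRegular (Ωᶜ ×ˢ Icc (0 : ℝ) 1) φ
  divFree : IsDivFree ((closure Ω)ᶜ ×ˢ Ioo (0 : ℝ) 1) φ
  cond_a : ∀ᵐ x : EuclideanSpace ℝ (Fin n), x ∉ closure Ω → ∀ t ∈ Icc (0 : ℝ) 1,
    (φ (x, t)).2 ≥ 1 / 4 * ‖(φ (x, t)).1‖ ^ 2 - γ ^ 2 * (Ioc (0 : ℝ) 1).indicator 1 t
  cond_b : ∀ᵐ x ∂(Measure.hausdorffMeasure ((n : ℝ) - 1) : Measure (EuclideanSpace ℝ (Fin n))),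
    x ∉ Ω → ∀ r s : ℝ, r < s →
      IntervalIntegrable (fun t => (φ (x, t)).1) volume r s ∧
      ‖∫ t in r..s, (φ (x, t)).1‖ ≤ β * (r ^ 2 + s ^ 2)
  cond_a' : ∀ᵐ x : EuclideanSpace ℝ (Fin n), x ∉ closure Ω →
    (φ (x, u x)).1 = (2 : ℝ) • g x ∧
    (φ (x, u x)).2 = ‖g x‖ ^ 2 - γ ^ 2 * (Ioc (0 : ℝ) 1).indicator 1 (u x)
  cond_b' : ∀ᵐ x ∂(Measure.hausdorffMeasure ((n : ℝ) - 1) : Measure (EuclideanSpace ℝ (Fin n))),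
    ∀ (a b : ℝ) (ν : EuclideanSpace ℝ (Fin n)), IsJump u x a b ν →
      ∫ t in a..b, (φ (x, t)).1 = (β * (a ^ 2 + b ^ 2)) • ν

/-- `u` is an admissible function (`u ∈ SBV(ℝⁿ)`, `u = 1` on `Ω`, `0 ≤ u ≤ 1`, compact support)
which has a calibration. -/
def IsCalibrated {n : ℕ} (Ω : Set (EuclideanSpace ℝ (Fin n))) (β γ : ℝ)
    (u : EuclideanSpace ℝ (Fin n) → ℝ) : Prop :=
  (∀ x ∈ Ω, u x = 1) ∧ (∀ x, 0 ≤ u x ∧ u x ≤ 1) ∧ HasCompactSupport u ∧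
  ∃ g, IsSBVWithGradient u g ∧ ∃ φ, IsCalibration Ω β γ u g φ

/-- The radial profile `Γ` (for `n ≥ 1` and `r > 0`). -/
def Gam (n : ℕ) (r : ℝ) : ℝ :=
  if n = 1 then r - 1
  else if n = 2 then Real.log r
  else 1 / ((n : ℝ) - 2) * (1 - r ^ (2 - (n : ℤ)))

/-- `δ(r) = 1 / (1 + β rⁿ⁻¹ Γ(r))` (for `n ≥ 1`). -/
def delta (n : ℕ) (β r : ℝ) : ℝ := 1 / (1 + β * r ^ (n - 1) * Gam n r)

/-- The radial function `u` of parameter `R`. -/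
def radialU (n : ℕ) (β R : ℝ) (x : EuclideanSpace ℝ (Fin n)) : ℝ :=
  if ‖x‖ ≤ 1 then 1
  else if ‖x‖ ≤ R then 1 - β * delta n β R * R ^ (n - 1) * Gam n ‖x‖
  else 0

end ThermalInsulation

end

/-!
`u` is calibrated by a field which is constant on vertical lines above the graph of an explicit
radial function `B` (`barrier`), and zero below it.  Write `c = β δ(R) R^{n-1}` and
`k(r) = c / r^{n-1}`, so that `|∇u| = k(|x|)` on the annulus.  The vertical translates of the graph
of the radial harmonic function `1 - c Γ(|x|)` foliate space, and `Φ = (2∇u, |∇u|² - γ²)`, where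
`∇u` stands for `-c x / |x|ⁿ`, is the corresponding divergence-free field (`flow`).  The calibration
`φ` (`calib`) equals `Φ` above the graph of `B` and `0` below.  It stays divergence-free precisely
if no flux crosses the graph, that is `B' = -(k² - γ²) / (2k)`, and `cond_b'` at `|x| = R`
forces `B(R) = δ(R) / 2`.

Then `cond_a`, `cond_a'` and `cond_b'` are direct computations, and `cond_b` reduces to
`2 k (s - B) ≤ β s²` for all `s`, i.e. to the discriminant inequality `k ≤ 2 β B`
(`slope_le_two_mul_barrier`).  The difference `2 β B - k` vanishes at `R`; by the
Euler–Lagrange relation between `R` and `γ` its derivative has the sign of the difference of the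
values of `w ↦ (β - (n-1) w) w^{2(n-1)}` at `1/R` and at `1/r`.  That function is nondecreasing
on `[0, 1]` because `β ≥ n - 1/2`, so `2 β B - k` has its minimum at `R`.

The remaining points are measure theoretic.
* Divergence (`isDivFree_calib`): a shear flattens the graph of `B`; in polar coordinates the
  integrand is then, along each ray, the derivative of a compactly supported function.
* Approximate regularity (`isBoundedApproxRegular_calib`): `φ` is continuous off the graph of `B`.
  On the graph, at almost every point of a hypersurface `M`, the intersection of `M` with the graph
  has density one (in the parametrization by `x`), so that a normal to `M` is also normal to the
  graph, hence orthogonal to `Φ`.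
* Jump set (`isJump_radialU`, `IsJump.radialU_eq`): one-sided approximate limits are read off from
  the pointwise blow-up limit of `u`, which is a constant off the sphere `|x| = R` and a
  two-valued step function on it.
* Derivative of `u` (`isSBVWithGradient_radialU`): `u` is the sum of a Lipschitz radial function and
  of `δ(R)` times the indicator function of the ball of radius `R`, for which the divergence theorem
  is obtained by approximating the indicator function with Lipschitz cutoffs.
-/

noncomputable section

namespace ThermalInsulation

/-! ### The radial profile and the barrier -/

theorem hasDerivAt_Gam {n : ℕ} (hn : 1 ≤ n) {r : ℝ} (hr : 0 < r) :
    HasDerivAt (Gam n) (1 / r ^ (n - 1)) r := by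
  by_cases h1 : n = 1
  · subst h1
    have : Gam 1 = fun r => r - 1 := by ext; simp [Gam]
    rw [this]
    simpa using (hasDerivAt_id r).sub_const 1
  by_cases h2 : n = 2
  · subst h2
    have : Gam 2 = Real.log := by ext; simp [Gam]
    rw [this]
    simpa using Real.hasDerivAt_log hr.ne'
  have : Gam n = fun r => 1 / ((n : ℝ) - 2) * (1 - r ^ (2 - (n : ℤ))) := by
    ext; simp [Gam, h1, h2]
  rw [this]
  have hd := (((hasDerivAt_zpow (2 - (n : ℤ)) r (Or.inl hr.ne')).const_sub 1).const_mul
    (1 / ((n : ℝ) - 2)))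
  have hn2 : (n : ℝ) - 2 ≠ 0 := by
    intro h
    exact h2 (by exact_mod_cast sub_eq_zero.1 h)
  refine hd.congr_deriv ?_
  have : (2 - (n : ℤ) - 1) = -((n - 1 : ℕ) : ℤ) := by omega
  rw [this, zpow_neg, zpow_natCast]
  push_cast
  field_simp
  ring

theorem Gam_one (n : ℕ) : Gam n 1 = 0 := by
  unfold Gam; split_ifs <;> simp

theorem monotoneOn_Gam {n : ℕ} (hn : 1 ≤ n) : MonotoneOn (Gam n) (Ioi 0) := by
  refine monotoneOn_of_deriv_nonneg (convex_Ioi 0)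
    (fun r hr => (hasDerivAt_Gam hn hr).continuousAt.continuousWithinAt) ?_ ?_
  · intro r hr
    rw [interior_Ioi] at hr
    exact (hasDerivAt_Gam hn hr).differentiableAt.differentiableWithinAt
  · intro r hr
    rw [interior_Ioi] at hr
    rw [(hasDerivAt_Gam hn hr).deriv]
    have : 0 < r := hr
    positivity

theorem Gam_mono {n : ℕ} (hn : 1 ≤ n) {r s : ℝ} (hr : 0 < r) (hrs : r ≤ s) : Gam n r ≤ Gam n s :=
  monotoneOn_Gam hn hr (hr.trans_le hrs) hrs

theorem Gam_nonneg {n : ℕ} (hn : 1 ≤ n) {r : ℝ} (hr : 1 ≤ r) : 0 ≤ Gam n r :=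
  (Gam_one n).symm.le.trans (Gam_mono hn one_pos hr)

theorem measurable_Gam (n : ℕ) : Measurable (Gam n) := by
  unfold Gam
  split_ifs
  · fun_prop
  · fun_prop
  · fun_prop

/-- The constant `c = β δ(R) R^{n-1}`: on the annulus, `|∇u| = c / r^{n-1}`. -/
def slopeConst (n : ℕ) (β R : ℝ) : ℝ := β * delta n β R * R ^ (n - 1)

/-- The height `B(r)` of the interface at distance `r` from the origin, below which the calibration
vanishes.  It solves `B' = -(k² - γ²) / (2k)` with `k = c / r^{n-1}` and `B(R) = δ(R) / 2`. -/
def barrier (n : ℕ) (β γ R r : ℝ) : ℝ :=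
  delta n β R / 2 - slopeConst n β R / 2 * (Gam n r - Gam n R)
    + γ ^ 2 / (2 * slopeConst n β R) * ((r ^ n - R ^ n) / n)

section
variable {n : ℕ} {β γ R : ℝ}

theorem delta_pos (hn : 1 ≤ n) (hβ : 0 < β) (hR : 1 ≤ R) : 0 < delta n β R := by
  have := Gam_nonneg hn hR
  unfold delta
  positivity

theorem one_sub_slopeConst_mul_Gam (hn : 1 ≤ n) (hβ : 0 < β) (hR : 1 ≤ R) :
    1 - slopeConst n β R * Gam n R = delta n β R := by
  have := Gam_nonneg hn hR
  have h : 1 + β * R ^ (n - 1) * Gam n R ≠ 0 := by positivity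
  unfold slopeConst delta
  field_simp
  ring

theorem slopeConst_pos (hn : 1 ≤ n) (hβ : 0 < β) (hR : 1 ≤ R) : 0 < slopeConst n β R := by
  have := delta_pos hn hβ hR
  unfold slopeConst
  positivity

theorem barrier_self : barrier n β γ R R = delta n β R / 2 := by simp [barrier]

theorem hasDerivAt_barrier (hn : 1 ≤ n) (hβ : 0 < β) (hR : 1 ≤ R) {r : ℝ} (hr : 0 < r) :
    HasDerivAt (barrier n β γ R)
      (-((slopeConst n β R / r ^ (n - 1)) ^ 2 - γ ^ 2) / (2 * (slopeConst n β R / r ^ (n - 1)))) r := by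
  have hc := slopeConst_pos hn hβ hR
  have h := ((((hasDerivAt_Gam hn hr).sub_const (Gam n R)).const_mul
    (slopeConst n β R / 2)).const_sub (delta n β R / 2)).add
    ((((hasDerivAt_pow n r).sub_const (R ^ n)).div_const (n : ℝ)).const_mul
      (γ ^ 2 / (2 * slopeConst n β R)))
  refine h.congr_deriv ?_
  have : (n : ℝ) ≠ 0 := by positivity
  field_simp
  ring

theorem barrier_lt_of_le (hn : 1 ≤ n) (hβ : 0 < β) (hR : 1 ≤ R) {r : ℝ} (hr : 1 ≤ r)
    (hrR : r ≤ R) : barrier n β γ R r < 1 - slopeConst n β R * Gam n r := by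
  have hc := slopeConst_pos hn hβ hR
  have hG := Gam_mono hn (by linarith) hrR
  have hp : r ^ n ≤ R ^ n := by gcongr
  have h1 : γ ^ 2 / (2 * slopeConst n β R) * ((r ^ n - R ^ n) / n) ≤ 0 :=
    mul_nonpos_of_nonneg_of_nonpos (by positivity)
      (div_nonpos_of_nonpos_of_nonneg (by linarith) (by positivity))
  have h2 := one_sub_slopeConst_mul_Gam hn hβ hR
  have h3 := delta_pos hn hβ hR
  have h4 : slopeConst n β R * Gam n r ≤ slopeConst n β R * Gam n R := by gcongr
  unfold barrier
  linarith

/-- The elementary inequality behind the hypothesis `β ≥ n - 1/2`: the function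
`w ↦ (β - (n-1) w) w^{2(n-1)}` is nondecreasing on `[0, 1]`. -/
theorem monotoneOn_sub_mul_pow (hn : 1 ≤ n) (hβ : (n : ℝ) - 1 / 2 ≤ β) :
    MonotoneOn (fun w : ℝ => (β - ((n : ℝ) - 1) * w) * w ^ (2 * (n - 1))) (Icc 0 1) := by
  obtain ⟨m, rfl⟩ : ∃ m, n = m + 1 := ⟨n - 1, by omega⟩
  have hd : ∀ w : ℝ, HasDerivAt (fun w : ℝ => (β - (((m + 1 : ℕ) : ℝ) - 1) * w) * w ^ (2 * m))
      (-(m : ℝ) * w ^ (2 * m) + (β - m * w) * ((2 * m : ℕ) * w ^ (2 * m - 1))) w := by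
    intro w
    have := (((hasDerivAt_id w).const_mul (m : ℝ)).const_sub β).mul (hasDerivAt_pow (2 * m) w)
    push_cast at this ⊢
    simpa [Pi.mul_def] using this
  refine monotoneOn_of_deriv_nonneg (convex_Icc 0 1)
    (fun w _ => (hd w).continuousAt.continuousWithinAt)
    (fun w _ => (hd w).differentiableAt.differentiableWithinAt) ?_
  intro w hw
  rw [interior_Icc] at hw
  have hw0 := hw.1
  have hw1 := hw.2
  simp only [Nat.add_sub_cancel]
  rw [(hd w).deriv]
  rcases Nat.eq_zero_or_pos m with rfl | hm
  · simp
  have hpow : w ^ (2 * m) = w * w ^ (2 * m - 1) := by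
    rw [← pow_succ']; congr 1; omega
  rw [hpow]
  push_cast at hβ ⊢
  have hm' : (1 : ℝ) ≤ m := by exact_mod_cast hm
  have key : 0 ≤ 2 * β - (2 * m + 1) * w := by nlinarith
  have : -(m : ℝ) * (w * w ^ (2 * m - 1)) + (β - m * w) * (2 * m * w ^ (2 * m - 1)) =
    m * w ^ (2 * m - 1) * (2 * β - (2 * m + 1) * w) := by ring
  rw [this]
  positivity

/-- The left-hand side is the derivative of `2βB - k` at `r`, divided by `k(r)`.  By the
Euler–Lagrange relation it compares the values at `1/R` and `1/r` of the function of
`monotoneOn_sub_mul_pow`. -/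
theorem rate_eq (hn : 1 ≤ n) (hβ0 : 0 < β) (hR : 1 ≤ R)
    (hEL : (β ^ 2 - β * ((n : ℝ) - 1) / R) * delta n β R ^ 2 = γ ^ 2) {r : ℝ} (hr : 0 < r) :
    ((n : ℝ) - 1) / r - β + β * γ ^ 2 / (slopeConst n β R / r ^ (n - 1)) ^ 2 =
      r ^ (2 * (n - 1)) * ((β - ((n : ℝ) - 1) * R⁻¹) * R⁻¹ ^ (2 * (n - 1)) -
        (β - ((n : ℝ) - 1) * r⁻¹) * r⁻¹ ^ (2 * (n - 1))) := by
  have hδ := delta_pos hn hβ0 hR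
  have hR0 : 0 < R := by linarith
  rw [← hEL, slopeConst, pow_mul', pow_mul', pow_mul']
  simp only [inv_pow]
  field_simp
  ring

/-- The inequality `k ≤ 2βB` on `[1, ∞)`: the difference `2βB - k` vanishes at `R`, decreases
before `R` and increases after it. -/
theorem slope_le_two_mul_barrier (hn : 1 ≤ n) (hβ : (n : ℝ) - 1 / 2 ≤ β) (hR : 1 ≤ R)
    (hEL : (β ^ 2 - β * ((n : ℝ) - 1) / R) * delta n β R ^ 2 = γ ^ 2) {r : ℝ} (hr : 1 ≤ r) :
    slopeConst n β R / r ^ (n - 1) ≤ 2 * β * barrier n β γ R r := by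
  have hn' : (1 : ℝ) ≤ n := by exact_mod_cast hn
  have hβ0 : 0 < β := by linarith
  have hc := slopeConst_pos hn hβ0 hR
  set c := slopeConst n β R with hcdef
  let D : ℝ → ℝ := fun r => 2 * β * barrier n β γ R r - c / r ^ (n - 1)
  have hDR : D R = 0 := by
    have : R ≠ 0 := by linarith
    simp only [D, barrier_self, hcdef, slopeConst]
    field_simp
    ring
  have hD : ∀ s : ℝ, 0 < s → HasDerivAt D (c / s ^ (n - 1) *
      (s ^ (2 * (n - 1)) * ((β - ((n : ℝ) - 1) * R⁻¹) * R⁻¹ ^ (2 * (n - 1)) -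
        (β - ((n : ℝ) - 1) * s⁻¹) * s⁻¹ ^ (2 * (n - 1))))) s := by
    intro s hs
    rw [← rate_eq hn hβ0 hR hEL hs]
    have h1 := (hasDerivAt_barrier (γ := γ) hn hβ0 hR hs).const_mul (2 * β)
    have h2 := (((hasDerivAt_pow (n - 1) s).inv (by positivity)).const_mul c)
    refine (h1.sub h2).congr_deriv ?_
    rw [← hcdef]
    have : (((n - 1 : ℕ) : ℝ)) = (n : ℝ) - 1 := by push_cast [hn]; ring
    rw [this]
    rcases Nat.eq_or_lt_of_le hn with h | h
    · subst h; simp; field_simp; ring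
    have hp : s ^ (n - 1) = s * s ^ (n - 1 - 1) := by
      rw [← pow_succ']; congr 1; omega
    rw [hp]
    field_simp
    ring
  have hp := monotoneOn_sub_mul_pow hn hβ
  have hmem : ∀ s : ℝ, 1 ≤ s → s⁻¹ ∈ Icc (0 : ℝ) 1 :=
    fun s hs => ⟨by positivity, inv_le_one_of_one_le₀ hs⟩
  suffices 0 ≤ D r by simpa [D] using this
  rw [← hDR]
  rcases le_total r R with h | h
  · have hanti : AntitoneOn D (Icc 1 R) := by
      refine antitoneOn_of_deriv_nonpos (convex_Icc 1 R)
        (fun s hs => (hD s (by linarith [hs.1])).continuousAt.continuousWithinAt) ?_ ?_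
      · intro s hs
        rw [interior_Icc] at hs
        exact (hD s (by linarith [hs.1])).differentiableAt.differentiableWithinAt
      · intro s hs
        rw [interior_Icc] at hs
        have hs0 : 0 < s := by linarith [hs.1]
        rw [(hD s hs0).deriv]
        have := hp (hmem R hR) (hmem s hs.1.le) (inv_anti₀ hs0 hs.2.le)
        simp only at this
        exact mul_nonpos_of_nonneg_of_nonpos (by positivity)
          (mul_nonpos_of_nonneg_of_nonpos (by positivity) (by linarith))
    exact hanti ⟨hr, h⟩ ⟨hR, le_rfl⟩ h
  · have hmono : MonotoneOn D (Ici R) := by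
      refine monotoneOn_of_deriv_nonneg (convex_Ici R)
        (fun s hs => (hD s (by linarith [mem_Ici.1 hs])).continuousAt.continuousWithinAt) ?_ ?_
      · intro s hs
        rw [interior_Ici] at hs
        exact (hD s (by linarith [mem_Ioi.1 hs])).differentiableAt.differentiableWithinAt
      · intro s hs
        rw [interior_Ici, mem_Ioi] at hs
        have hs0 : 0 < s := by linarith
        rw [(hD s hs0).deriv]
        have := hp (hmem s (by linarith)) (hmem R hR) (inv_anti₀ (by linarith) hs.le)
        simp only at this
        have : 0 ≤ (β - ((n : ℝ) - 1) * R⁻¹) * R⁻¹ ^ (2 * (n - 1)) -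
          (β - ((n : ℝ) - 1) * s⁻¹) * s⁻¹ ^ (2 * (n - 1)) := by linarith
        positivity
    exact hmono (mem_Ici.2 le_rfl) h h

theorem barrier_pos (hn : 1 ≤ n) (hβ : (n : ℝ) - 1 / 2 ≤ β) (hR : 1 ≤ R)
    (hEL : (β ^ 2 - β * ((n : ℝ) - 1) / R) * delta n β R ^ 2 = γ ^ 2) {r : ℝ} (hr : 1 ≤ r) :
    0 < barrier n β γ R r := by
  have hn' : (1 : ℝ) ≤ n := by exact_mod_cast hn
  have hβ0 : 0 < β := by linarith
  have hc := slopeConst_pos hn hβ0 hR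
  have h1 : 0 < slopeConst n β R / r ^ (n - 1) := by positivity
  have h2 := slope_le_two_mul_barrier hn hβ hR hEL hr
  have h3 : 0 < 2 * β * barrier n β γ R r := h1.trans_le h2
  exact pos_of_mul_pos_right h3 (by positivity)

end

/-! ### The calibration -/

/-- `max |x| 1`.  All fields are built from this continuous positive function instead of `|x|`; this
changes nothing outside `Ω` and avoids the singularity at the origin. -/
def radius {n : ℕ} (x : EuclideanSpace ℝ (Fin n)) : ℝ := max ‖x‖ 1

/-- The field `(2∇w, |∇w|² - γ²)` common to all vertical translates of the graph of the radial
solution `w`, for which `∇w = -c x / |x|ⁿ`. -/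
def flow {n : ℕ} (c γ : ℝ) (x : EuclideanSpace ℝ (Fin n)) : EuclideanSpace ℝ (Fin n) × ℝ :=
  (-(2 * c / radius x ^ n) • x, (c / radius x ^ (n - 1)) ^ 2 - γ ^ 2)

/-- The calibration: the field `flow` above the graph of the barrier, and zero below it. -/
def calib {n : ℕ} (β γ R : ℝ) (p : EuclideanSpace ℝ (Fin n) × ℝ) : EuclideanSpace ℝ (Fin n) × ℝ :=
  if barrier n β γ R (radius p.1) < p.2 then flow (slopeConst n β R) γ p.1 else 0

/-- The density of the absolutely continuous part of `Du`. -/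
def gradU {n : ℕ} (β R : ℝ) (x : EuclideanSpace ℝ (Fin n)) : EuclideanSpace ℝ (Fin n) :=
  if 1 < ‖x‖ ∧ ‖x‖ < R then -(slopeConst n β R / ‖x‖ ^ n) • x else 0

section
variable {n : ℕ} {β γ R : ℝ} {x : EuclideanSpace ℝ (Fin n)}

theorem one_le_radius (x : EuclideanSpace ℝ (Fin n)) : 1 ≤ radius x := le_max_right _ _

theorem radius_of_one_le (h : 1 ≤ ‖x‖) : radius x = ‖x‖ := max_eq_left h

theorem continuous_radius : Continuous (radius : EuclideanSpace ℝ (Fin n) → ℝ) := by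
  unfold radius; fun_prop

theorem continuous_flow (c γ : ℝ) :
    Continuous (flow c γ : EuclideanSpace ℝ (Fin n) → EuclideanSpace ℝ (Fin n) × ℝ) := by
  have h := continuous_radius (n := n)
  have h0 : ∀ (x : EuclideanSpace ℝ (Fin n)) k, radius x ^ k ≠ 0 :=
    fun x k => (pow_pos (one_pos.trans_le (one_le_radius x)) k).ne'
  unfold flow
  have h1 : Continuous fun x : EuclideanSpace ℝ (Fin n) => 2 * c / radius x ^ n :=
    continuous_const.div (h.pow n) fun x => h0 x n
  have h2 : Continuous fun x : EuclideanSpace ℝ (Fin n) => c / radius x ^ (n - 1) :=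
    continuous_const.div (h.pow _) fun x => h0 x _
  fun_prop

theorem continuous_barrier_radius (hn : 1 ≤ n) (hβ : 0 < β) (hR : 1 ≤ R) :
    Continuous fun x : EuclideanSpace ℝ (Fin n) => barrier n β γ R (radius x) := by
  refine continuous_iff_continuousAt.2 fun x => ?_
  exact (hasDerivAt_barrier hn hβ hR (one_pos.trans_le (one_le_radius x))).continuousAt.comp
    continuous_radius.continuousAt

theorem measurable_calib (hn : 1 ≤ n) (hβ : 0 < β) (hR : 1 ≤ R) :
    Measurable (calib (n := n) β γ R) := by
  refine Measurable.ite ?_ ((continuous_flow _ _).comp continuous_fst).measurable measurable_const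
  exact measurableSet_lt ((continuous_barrier_radius hn hβ hR).comp continuous_fst).measurable
    measurable_snd

theorem norm_flow_fst (hn : 1 ≤ n) {c : ℝ} (hc : 0 ≤ c) (hx : 1 ≤ ‖x‖) :
    ‖(flow c γ x).1‖ = 2 * (c / ‖x‖ ^ (n - 1)) := by
  have h0 : 0 < ‖x‖ := by linarith
  have hp : ‖x‖ ^ n = ‖x‖ * ‖x‖ ^ (n - 1) := by rw [← pow_succ']; congr 1; omega
  simp only [flow, radius_of_one_le hx]
  rw [norm_smul, norm_neg, Real.norm_of_nonneg (by positivity), hp]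
  field_simp

theorem norm_calib_le (hn : 1 ≤ n) (hβ : 0 < β) (hR : 1 ≤ R)
    (p : EuclideanSpace ℝ (Fin n) × ℝ) :
    ‖calib β γ R p‖ ≤ 2 * slopeConst n β R + slopeConst n β R ^ 2 + γ ^ 2 := by
  have hc := slopeConst_pos hn hβ hR
  unfold calib
  split_ifs
  · have h1 := one_le_radius p.1
    have hr0 : 0 < radius p.1 := by linarith
    have hk : slopeConst n β R / radius p.1 ^ (n - 1) ≤ slopeConst n β R :=
      div_le_self hc.le (one_le_pow₀ h1)
    have hk0 : 0 ≤ slopeConst n β R / radius p.1 ^ (n - 1) := by positivity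
    have hsq : (slopeConst n β R / radius p.1 ^ (n - 1)) ^ 2 ≤ slopeConst n β R ^ 2 := by gcongr
    refine max_le ?_ ?_
    · have hp : radius p.1 ^ n = radius p.1 * radius p.1 ^ (n - 1) := by
        rw [← pow_succ']; congr 1; omega
      have hx : ‖p.1‖ ≤ radius p.1 := le_max_left _ _
      simp only [flow]
      rw [norm_smul, norm_neg, Real.norm_of_nonneg (by positivity)]
      calc 2 * slopeConst n β R / radius p.1 ^ n * ‖p.1‖
          ≤ 2 * slopeConst n β R / radius p.1 ^ n * radius p.1 := by gcongr
        _ = 2 * (slopeConst n β R / radius p.1 ^ (n - 1)) := by rw [hp]; field_simp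
        _ ≤ _ := by nlinarith [sq_nonneg γ]
    · simp only [flow]
      rw [Real.norm_eq_abs, abs_le]
      constructor <;> nlinarith [sq_nonneg γ, sq_nonneg (slopeConst n β R)]
  · simp only [norm_zero]; positivity

theorem integral_indicator_Ioi_const {V : Type*} [NormedAddCommGroup V] [NormedSpace ℝ V]
    [CompleteSpace V] (X : V) (b : ℝ) {r s : ℝ} (hrs : r ≤ s) :
    ∫ t in r..s, (if b < t then X else 0) = max (s - max r b) 0 • X := by
  have : (fun t => if b < t then X else 0) = (Ioi b).indicator fun _ => X := by
    ext t; simp [indicator]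
  rw [this, intervalIntegral.integral_of_le hrs, setIntegral_indicator measurableSet_Ioi,
    Ioc_inter_Ioi, setIntegral_const, Real.volume_real_Ioc]

theorem calib_fst (x : EuclideanSpace ℝ (Fin n)) (t : ℝ) :
    (calib β γ R (x, t)).1 =
      if barrier n β γ R (radius x) < t then (flow (slopeConst n β R) γ x).1 else 0 := by
  unfold calib; split_ifs <;> rfl

theorem intervalIntegrable_calib_fst (hn : 1 ≤ n) (hβ : 0 < β) (hR : 1 ≤ R)
    (x : EuclideanSpace ℝ (Fin n)) (r s : ℝ) :
    IntervalIntegrable (fun t => (calib β γ R (x, t)).1) volume r s := by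
  have hm : Measurable fun t => (calib (n := n) β γ R (x, t)).1 :=
    ((measurable_calib hn hβ hR).comp measurable_prodMk_left).fst
  refine (intervalIntegrable_const (c := 2 * slopeConst n β R + slopeConst n β R ^ 2 + γ ^ 2)).mono_fun
    hm.aestronglyMeasurable (Eventually.of_forall fun t => ?_)
  exact (norm_fst_le _).trans ((norm_calib_le hn hβ hR _).trans (le_abs_self _))

/-- The flux bound `cond_b`.  It holds on all of `ℝ`, without cutting `calib` off
outside `[0, 1]`. -/
theorem norm_integral_calib_fst_le (hn : 1 ≤ n) (hβ : (n : ℝ) - 1 / 2 ≤ β) (hR : 1 ≤ R)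
    (hEL : (β ^ 2 - β * ((n : ℝ) - 1) / R) * delta n β R ^ 2 = γ ^ 2) (hx : 1 ≤ ‖x‖)
    {r s : ℝ} (hrs : r < s) :
    ‖∫ t in r..s, (calib β γ R (x, t)).1‖ ≤ β * (r ^ 2 + s ^ 2) := by
  have hn' : (1 : ℝ) ≤ n := by exact_mod_cast hn
  have hβ0 : 0 < β := by linarith
  have hc := slopeConst_pos hn hβ0 hR
  simp only [calib_fst]
  rw [integral_indicator_Ioi_const _ _ hrs.le, norm_smul, Real.norm_of_nonneg (le_max_right _ _),
    norm_flow_fst hn hc.le hx, radius_of_one_le hx]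
  have h1 := slope_le_two_mul_barrier hn hβ hR hEL hx
  have h2 := barrier_pos hn hβ hR hEL hx
  set k := slopeConst n β R / ‖x‖ ^ (n - 1)
  have hk : 0 < k := by positivity
  set B := barrier n β γ R ‖x‖
  rcases le_total s (max r B) with h | h
  · rw [max_eq_right (by linarith), zero_mul]
    positivity
  · rw [max_eq_left (by linarith)]
    have hB : B ≤ s := (le_max_right _ _).trans h
    calc (s - max r B) * (2 * k) ≤ (s - B) * (2 * k) := by gcongr; exact le_max_right _ _
      _ ≤ (s - B) * (2 * (2 * β * B)) := by
          have : 0 ≤ s - B := by linarith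
          gcongr
      _ ≤ β * (r ^ 2 + s ^ 2) := by
          -- the discriminant condition `k ≤ 2βB` turns the estimate into a perfect square
          have : 0 ≤ β * ((s - 2 * B) ^ 2 + r ^ 2) := by positivity
          nlinarith

/-- At the jump set the calibration saturates the estimate of `norm_integral_calib_fst_le`. -/
theorem integral_calib_fst_of_norm_eq (hn : 1 ≤ n) (hβ : 0 < β) (hR : 1 ≤ R) (hx : ‖x‖ = R) :
    ∫ t in (0 : ℝ)..delta n β R, (calib β γ R (x, t)).1 =
      (β * (0 ^ 2 + delta n β R ^ 2)) • (-R⁻¹ • x) := by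
  have hδ := delta_pos hn hβ hR
  simp only [calib_fst]
  rw [integral_indicator_Ioi_const _ _ hδ.le, radius_of_one_le (by rw [hx]; exact hR), hx,
    barrier_self, max_eq_right (by linarith : (0 : ℝ) ≤ delta n β R / 2),
    max_eq_left (by linarith)]
  simp only [flow]
  rw [radius_of_one_le (by rw [hx]; exact hR), hx, smul_smul, smul_smul]
  congr 1
  have hp : R ^ n = R * R ^ (n - 1) := by rw [← pow_succ']; congr 1; omega
  have hR0 : R ≠ 0 := by linarith
  rw [hp, slopeConst]
  field_simp
  ring

theorem le_calib_snd (hn : 1 ≤ n) (hβ : (n : ℝ) - 1 / 2 ≤ β) (hR : 1 ≤ R)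
    (hEL : (β ^ 2 - β * ((n : ℝ) - 1) / R) * delta n β R ^ 2 = γ ^ 2) (hx : 1 ≤ ‖x‖)
    {t : ℝ} (ht : t ∈ Icc (0 : ℝ) 1) :
    (calib β γ R (x, t)).2 ≥
      1 / 4 * ‖(calib β γ R (x, t)).1‖ ^ 2 - γ ^ 2 * (Ioc (0 : ℝ) 1).indicator 1 t := by
  have hn' : (1 : ℝ) ≤ n := by exact_mod_cast hn
  have hβ0 : 0 < β := by linarith
  have hc := slopeConst_pos hn hβ0 hR
  have hB := barrier_pos hn hβ hR hEL (one_le_radius x)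
  unfold calib
  split_ifs with h
  · -- the barrier is positive, so the `γ²` term is present wherever the field does not vanish
    have ht0 : t ∈ Ioc (0 : ℝ) 1 := ⟨hB.trans h, ht.2⟩
    rw [norm_flow_fst hn hc.le hx, indicator_of_mem ht0]
    simp only [flow, radius_of_one_le hx, Pi.one_apply]
    ring_nf
    exact le_rfl
  · have : 0 ≤ (Ioc (0 : ℝ) 1).indicator (1 : ℝ → ℝ) t := indicator_nonneg (fun _ _ => zero_le_one) _
    have := mul_nonneg (sq_nonneg γ) this
    simpa using this

/-- The graph of `u` lies above the barrier on the annulus `1 < |x| < R`, and below it for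
`|x| > R`. -/
theorem calib_apply_radialU (hn : 1 ≤ n) (hβ : (n : ℝ) - 1 / 2 ≤ β) (hR : 1 ≤ R)
    (hEL : (β ^ 2 - β * ((n : ℝ) - 1) / R) * delta n β R ^ 2 = γ ^ 2) (hx : 1 < ‖x‖)
    (hxR : ‖x‖ ≠ R) :
    (calib β γ R (x, radialU n β R x)).1 = (2 : ℝ) • gradU β R x ∧
    (calib β γ R (x, radialU n β R x)).2 =
      ‖gradU β R x‖ ^ 2 - γ ^ 2 * (Ioc (0 : ℝ) 1).indicator 1 (radialU n β R x) := by
  have hn' : (1 : ℝ) ≤ n := by exact_mod_cast hn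
  have hβ0 : 0 < β := by linarith
  have hc := slopeConst_pos hn hβ0 hR
  have hB := barrier_pos hn hβ hR hEL hx.le
  rcases lt_or_gt_of_ne hxR with h | h
  · have hu : radialU n β R x = 1 - slopeConst n β R * Gam n ‖x‖ := by
      simp [radialU, hx.not_ge, h.le, slopeConst]
    have hlt := barrier_lt_of_le (γ := γ) hn hβ0 hR hx.le h.le
    have hG := Gam_nonneg hn hx.le
    have hmem : 1 - slopeConst n β R * Gam n ‖x‖ ∈ Ioc (0 : ℝ) 1 :=
      ⟨hB.trans hlt, by have := mul_nonneg hc.le hG; linarith⟩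
    have hp : ‖x‖ ^ n = ‖x‖ * ‖x‖ ^ (n - 1) := by rw [← pow_succ']; congr 1; omega
    have hx0 : ‖x‖ ≠ 0 := by linarith
    rw [hu, indicator_of_mem hmem]
    simp only [calib, radius_of_one_le hx.le, hlt, if_true, gradU, hx, h, and_self, flow]
    constructor
    · rw [smul_smul]; congr 1; ring
    · rw [norm_smul, norm_neg, Real.norm_of_nonneg (by positivity), hp]
      simp only [Pi.one_apply, mul_one, sub_left_inj]
      field_simp
  · have hu : radialU n β R x = 0 := by simp [radialU, hx.not_ge, h.not_ge]
    simp [hu, calib, radius_of_one_le hx.le, hB.not_gt, gradU, h.not_gt]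

end

/-! ### Polar coordinates -/

section
variable {E : Type*} [NormedAddCommGroup E] [NormedSpace ℝ E] [MeasurableSpace E] [BorelSpace E]
  [FiniteDimensional ℝ E] (μ : Measure E) [μ.IsAddHaarMeasure]

theorem integral_volumeIoiPow (k : ℕ) (g : ℝ → ℝ) :
    ∫ r : Ioi (0 : ℝ), g r ∂(Measure.volumeIoiPow k) = ∫ r in Ioi (0 : ℝ), r ^ k * g r := by
  simp only [Measure.volumeIoiPow, ENNReal.ofReal]
  rw [integral_withDensity_eq_integral_smul,
    integral_subtype_comap measurableSet_Ioi fun a ↦ Real.toNNReal (a ^ k) • g a,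
    setIntegral_congr_fun measurableSet_Ioi fun x hx ↦ ?_]
  · rw [NNReal.smul_def, Real.coe_toNNReal _ (pow_nonneg hx.out.le _), smul_eq_mul]
  · exact (measurable_subtype_coe.pow_const _).real_toNNReal

theorem integrable_comp_polar {F : E → ℝ} (hF : Integrable F μ) :
    Integrable (fun p : sphere (0 : E) 1 × Ioi (0 : ℝ) => F (p.2.1 • p.1.1))
      (μ.toSphere.prod (.volumeIoiPow (Module.finrank ℝ E - 1))) := by
  rw [← (μ.measurePreserving_homeomorphUnitSphereProd).integrable_comp_emb
    (Homeomorph.measurableEmbedding _)]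
  have : (fun p : sphere (0 : E) 1 × Ioi (0 : ℝ) => F (p.2.1 • p.1.1)) ∘
      (homeomorphUnitSphereProd E) = fun x : ({0}ᶜ : Set E) => F x := by
    ext x
    have hx : ‖x.1‖ ≠ 0 := norm_ne_zero_iff.2 x.2
    simp [smul_smul, hx]
  rw [this]
  have := hF.integrableOn (s := ({0}ᶜ : Set E))
  rwa [integrableOn_iff_comap_subtypeVal (measurableSet_singleton _).compl] at this

/-- Polar coordinates for non-radial functions.  The identity holds without integrability, both
sides being Bochner integrals over isomorphic measure spaces. -/
theorem integral_eq_integral_polar [Nontrivial E] (F : E → ℝ) :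
    ∫ x, F x ∂μ = ∫ p : sphere (0 : E) 1 × Ioi (0 : ℝ), F (p.2.1 • p.1.1)
      ∂(μ.toSphere.prod (.volumeIoiPow (Module.finrank ℝ E - 1))) := by
  rw [← (μ.measurePreserving_homeomorphUnitSphereProd).integral_comp
    (Homeomorph.measurableEmbedding _)]
  calc ∫ x, F x ∂μ = ∫ x : ({(0)}ᶜ : Set E), F x.1 ∂(μ.comap (↑)) := by
        rw [integral_subtype_comap (measurableSet_singleton _).compl fun x ↦ F x,
          restrict_compl_singleton]
    _ = _ := by
        refine integral_congr_ae (Eventually.of_forall fun x => ?_)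
        have hx : ‖x.1‖ ≠ 0 := norm_ne_zero_iff.2 x.2
        simp [smul_smul, hx]

theorem integral_eq_integral_sphere_integral_ray [Nontrivial E] {F : E → ℝ} (hF : Integrable F μ) :
    ∫ x, F x ∂μ = ∫ θ : sphere (0 : E) 1, (∫ r in Ioi (0 : ℝ),
      r ^ (Module.finrank ℝ E - 1) * F (r • θ.1)) ∂μ.toSphere := by
  rw [integral_eq_integral_polar, integral_prod _ (integrable_comp_polar μ hF)]
  refine integral_congr_ae (Eventually.of_forall fun θ => ?_)
  exact integral_volumeIoiPow _ fun r => F (r • θ.1)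

theorem integral_eq_integral_radius_integral_sphere [Nontrivial E] {F : E → ℝ} (hF : Integrable F μ) :
    ∫ x, F x ∂μ = ∫ r in Ioi (0 : ℝ),
      r ^ (Module.finrank ℝ E - 1) * ∫ θ : sphere (0 : E) 1, F (r • θ.1) ∂μ.toSphere := by
  rw [integral_eq_integral_polar, integral_prod_symm _ (integrable_comp_polar μ hF)]
  exact integral_volumeIoiPow _ fun r => ∫ θ : sphere (0 : E) 1, F (r • θ.1) ∂μ.toSphere

end

/-! ### The calibration is divergence-free -/

section
variable {n : ℕ} {β γ R : ℝ}

/-- The shear `(x, τ) ↦ (x, τ + B(|x|))`, which straightens the interface. -/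
def shear (hn : 1 ≤ n) (hβ : 0 < β) (hR : 1 ≤ R) (γ : ℝ) :
    (EuclideanSpace ℝ (Fin n) × ℝ) ≃ₜ (EuclideanSpace ℝ (Fin n) × ℝ) where
  toFun p := (p.1, p.2 + barrier n β γ R (radius p.1))
  invFun p := (p.1, p.2 - barrier n β γ R (radius p.1))
  left_inv p := by simp
  right_inv p := by simp
  continuous_toFun := by
    have := (continuous_barrier_radius (γ := γ) hn hβ hR).comp
      (continuous_fst : Continuous (Prod.fst : EuclideanSpace ℝ (Fin n) × ℝ → _))
    simp only [Function.comp_def] at this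
    fun_prop
  continuous_invFun := by
    have := (continuous_barrier_radius (γ := γ) hn hβ hR).comp
      (continuous_fst : Continuous (Prod.fst : EuclideanSpace ℝ (Fin n) × ℝ → _))
    simp only [Function.comp_def] at this
    fun_prop

theorem shear_apply (hn : 1 ≤ n) (hβ : 0 < β) (hR : 1 ≤ R) (p : EuclideanSpace ℝ (Fin n) × ℝ) :
    shear hn hβ hR γ p = (p.1, p.2 + barrier n β γ R (radius p.1)) := rfl

theorem measurePreserving_shear (hn : 1 ≤ n) (hβ : 0 < β) (hR : 1 ≤ R) :
    MeasurePreserving (shear (n := n) hn hβ hR γ) := by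
  refine (MeasurePreserving.id (volume : Measure (EuclideanSpace ℝ (Fin n)))).skew_product
    (g := fun x t => t + barrier n β γ R (radius x)) ?_ (Eventually.of_forall fun x => ?_)
  · exact measurable_snd.add
      ((continuous_barrier_radius hn hβ hR).measurable.comp measurable_fst)
  · exact (measurePreserving_add_right volume _).map_eq

/-- Along a ray, in sheared coordinates, `r^{n-1} φ · ∇ψ` is a constant multiple of the derivative
of `ψ`: the field is tangent to the translates of the interface, and its horizontal part has
constant flux through spheres. -/
theorem hasDerivAt_ray (hn : 1 ≤ n) (hβ : 0 < β) (hR : 1 ≤ R)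
    {ψ : EuclideanSpace ℝ (Fin n) × ℝ → ℝ} (hψ : Differentiable ℝ ψ)
    {θ : EuclideanSpace ℝ (Fin n)} (hθ : ‖θ‖ = 1) (τ : ℝ) {r : ℝ} (hr : 1 < r) :
    HasDerivAt (fun r : ℝ => -(2 * slopeConst n β R) * ψ (r • θ, τ + barrier n β γ R r))
      (r ^ (n - 1) * fderiv ℝ ψ (shear hn hβ hR γ (r • θ, τ)) (flow (slopeConst n β R) γ (r • θ)))
      r := by
  have hr0 : 0 < r := by linarith
  have hc := slopeConst_pos hn hβ hR
  have hnorm : ‖r • θ‖ = r := by rw [norm_smul, hθ, mul_one, Real.norm_of_nonneg hr0.le]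
  have hrad : radius (r • θ) = r := by rw [radius_of_one_le (by rw [hnorm]; exact hr.le), hnorm]
  have h1 : HasDerivAt (fun r : ℝ => r • θ) θ r := by
    simpa using (hasDerivAt_id r).smul_const θ
  have h2 := (hasDerivAt_barrier (γ := γ) hn hβ hR hr0).const_add τ
  have h3 := ((hψ (r • θ, τ + barrier n β γ R r)).hasFDerivAt.comp_hasDerivAt r
    (h1.prodMk h2)).const_mul (-(2 * slopeConst n β R))
  refine h3.congr_deriv ?_
  simp only [shear_apply, hrad]
  rw [← smul_eq_mul, ← map_smul, ← smul_eq_mul (r ^ (n - 1)), ← map_smul]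
  congr 1
  have hp : r ^ n = r * r ^ (n - 1) := by rw [← pow_succ']; congr 1; omega
  simp only [flow, hrad, Prod.smul_mk, smul_smul, hp, smul_eq_mul]
  refine Prod.ext ?_ ?_
  · simp only
    congr 1
    field_simp
  · simp only
    field_simp

theorem isDivFree_calib (hn : 1 ≤ n) (hβ : 0 < β) (hR : 1 ≤ R) :
    IsDivFree ((closure (ball (0 : EuclideanSpace ℝ (Fin n)) 1))ᶜ ×ˢ Ioo (0 : ℝ) 1)
      (calib β γ R) := by
  intro ψ hψ hψc hsupp
  have : Nonempty (Fin n) := ⟨⟨0, hn⟩⟩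
  have hfd0 : ∀ p, p ∉ tsupport ψ → fderiv ℝ ψ p = 0 := fun p hp =>
    Function.notMem_support.1 fun h => hp (support_fderiv_subset ℝ h)
  have hout : ∀ p : EuclideanSpace ℝ (Fin n) × ℝ, ‖p.1‖ ≤ 1 → p ∉ tsupport ψ := by
    intro p hp hmem
    have := (hsupp hmem).1
    rw [closure_ball _ one_ne_zero] at this
    exact this (by simpa using hp)
  obtain ⟨m, hm⟩ : ∃ m : ℝ, ∀ p ∈ tsupport ψ, ‖p‖ ≤ m := hψc.isBounded.exists_norm_le
  have hdiff : Differentiable ℝ ψ := hψ.differentiable (by simp)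
  set F : EuclideanSpace ℝ (Fin n) × ℝ → ℝ :=
    fun p => fderiv ℝ ψ p (flow (slopeConst n β R) γ p.1) with hF
  have hFcont : Continuous F :=
    (hψ.continuous_fderiv (by simp)).clm_apply ((continuous_flow _ _).comp continuous_fst)
  have hF0 : ∀ p, p ∉ tsupport ψ → F p = 0 := fun p hp => by simp [hF, hfd0 p hp]
  have hFcomp : HasCompactSupport F := HasCompactSupport.intro hψc hF0
  set S := shear (n := n) hn hβ hR γ with hS
  have hint : Integrable (F ∘ S) := (hFcont.comp S.continuous).integrable_of_hasCompactSupport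
    (hFcomp.comp_homeomorph S)
  have hray : ∀ (τ : ℝ) (θ : sphere (0 : EuclideanSpace ℝ (Fin n)) 1),
      ∫ r in Ioi (0 : ℝ), r ^ (n - 1) * F (S (r • θ.1, τ)) = 0 := by
    intro τ θ
    have hθ : ‖θ.1‖ = 1 := by simp
    have hnorm : ∀ r : ℝ, ‖r • θ.1‖ = |r| := fun r => by rw [norm_smul, hθ, mul_one, Real.norm_eq_abs]
    have hcont : Continuous fun r : ℝ => r ^ (n - 1) * F (S (r • θ.1, τ)) := by
      have := hFcont.comp (S.continuous.comp
        ((continuous_id.smul continuous_const).prodMk continuous_const :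
          Continuous fun r : ℝ => (r • θ.1, τ)))
      simp only [Function.comp_def] at this
      fun_prop
    have hbig : ∀ (r t : ℝ), m < |r| → (r • θ.1, t) ∉ tsupport ψ := by
      intro r t hr hmem
      have := (norm_fst_le _).trans (hm _ hmem)
      rw [hnorm] at this
      linarith
    have hcomp : HasCompactSupport fun r : ℝ => r ^ (n - 1) * F (S (r • θ.1, τ)) := by
      refine HasCompactSupport.intro (isCompact_Icc (a := -m) (b := m)) fun r hr => ?_
      have : m < |r| := by
        by_contra h
        exact hr (abs_le.1 (not_lt.1 h))
      rw [hF0 (S (r • θ.1, τ)) (hbig r _ this), mul_zero]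
    have hG0 : ∀ r t : ℝ, (m < |r| ∨ |r| ≤ 1) → ψ (r • θ.1, t) = 0 := by
      intro r t hr
      refine image_eq_zero_of_notMem_tsupport ?_
      rcases hr with hr | hr
      · exact hbig r t hr
      · exact hout _ (by rw [hnorm]; exact hr)
    rw [setIntegral_eq_of_subset_of_forall_sdiff_eq_zero measurableSet_Ioi
      (Ioi_subset_Ioi (zero_le_one' ℝ))]
    · have hcontG : ContinuousWithinAt (fun r : ℝ => -(2 * slopeConst n β R) *
          ψ (r • θ.1, τ + barrier n β γ R r)) (Ici 1) 1 := by
        have hb := (hasDerivAt_barrier (γ := γ) hn hβ hR one_pos).continuousAt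
        have h1 : ContinuousAt (fun r : ℝ => (r • θ.1, τ + barrier n β γ R r)) 1 := by fun_prop
        exact (continuousAt_const.mul
          (ContinuousAt.comp (f := fun r : ℝ => (r • θ.1, τ + barrier n β γ R r))
            hψ.continuous.continuousAt h1)).continuousWithinAt
      have htend : Tendsto (fun r : ℝ => -(2 * slopeConst n β R) *
          ψ (r • θ.1, τ + barrier n β γ R r)) atTop (𝓝 0) := by
        refine tendsto_const_nhds.congr' ?_
        filter_upwards [eventually_gt_atTop m] with r hr
        rw [hG0 r _ (Or.inl (hr.trans_le (le_abs_self r))), mul_zero]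
      have hderiv : ∀ r ∈ Ioi (1 : ℝ), HasDerivAt (fun r : ℝ => -(2 * slopeConst n β R) *
          ψ (r • θ.1, τ + barrier n β γ R r)) (r ^ (n - 1) * F (S (r • θ.1, τ))) r :=
        fun r hr => hasDerivAt_ray hn hβ hR hdiff hθ τ hr
      rw [integral_Ioi_of_hasDerivAt_of_tendsto hcontG hderiv
        (hcont.integrable_of_hasCompactSupport hcomp).integrableOn htend,
        hG0 1 _ (Or.inr (by simp))]
      simp
    · intro r hr
      have h0 : 0 < r := hr.1
      have h1 : r ≤ 1 := not_lt.1 hr.2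
      rw [hF0 _ (hout _ (by rw [shear_apply, hnorm, abs_of_pos h0]; exact h1)), mul_zero]
  calc ∫ p in (closure (ball (0 : EuclideanSpace ℝ (Fin n)) 1))ᶜ ×ˢ Ioo (0 : ℝ) 1,
        fderiv ℝ ψ p (calib β γ R p) = ∫ p, fderiv ℝ ψ p (calib β γ R p) := by
        refine setIntegral_eq_integral_of_forall_compl_eq_zero fun p hp => ?_
        rw [hfd0 p fun h => hp (hsupp h)]; rfl
    _ = ∫ p : EuclideanSpace ℝ (Fin n) × ℝ,
          if barrier n β γ R (radius p.1) < p.2 then F p else 0 := by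
        congr 1; ext p
        unfold calib
        split_ifs <;> simp [hF]
    _ = ∫ p : EuclideanSpace ℝ (Fin n) × ℝ, if 0 < p.2 then F (S p) else 0 := by
        rw [← (measurePreserving_shear hn hβ hR).integral_comp S.measurableEmbedding]
        congr 1; ext p
        simp [hS, shear_apply]
    _ = ∫ p : EuclideanSpace ℝ (Fin n) × ℝ, (univ ×ˢ Ioi 0).indicator (F ∘ S) p := by
        congr 1; ext p; simp [indicator]
    _ = ∫ τ : ℝ, ∫ x : EuclideanSpace ℝ (Fin n), (univ ×ˢ Ioi 0).indicator (F ∘ S) (x, τ) := by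
        rw [Measure.volume_eq_prod]
        exact integral_prod_symm _ (hint.indicator (MeasurableSet.univ.prod measurableSet_Ioi))
    _ = ∫ τ : ℝ, 0 := by
        refine integral_congr_ae ?_
        have := hint
        rw [Measure.volume_eq_prod] at this
        filter_upwards [this.prod_left_ae] with τ hτ
        by_cases h : 0 < τ
        · simp only [indicator, mem_prod, mem_univ, mem_Ioi, h, and_self, if_true]
          rw [integral_eq_integral_sphere_integral_ray _ hτ, finrank_euclideanSpace_fin]
          simp only [Function.comp, hray, integral_zero]
        · simp [indicator, h]
    _ = 0 := by simp

end

/-! ### Approximate regularity -/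

section
variable {E : Type*} [NormedAddCommGroup E] [NormedSpace ℝ E] [MeasurableSpace E] [BorelSpace E]
  [FiniteDimensional ℝ E] (μ : Measure E) [μ.IsAddHaarMeasure]

open scoped Pointwise in
/-- The tangent cone of a set at a Lebesgue density point is the whole space: a linear form which
is `o(|y - x|)` on the set vanishes. -/
theorem eq_zero_of_isLittleO_of_density {s : Set E} {x : E}
    (hx : Tendsto (fun r => μ (s ∩ closedBall x r) / μ (closedBall x r)) (𝓝[>] 0) (𝓝 1))
    (ℓ : E →L[ℝ] ℝ) (h : (fun y => ℓ (y - x)) =o[𝓝[s] x] fun y => y - x) : ℓ = 0 := by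
  ext z
  suffices H : ∀ ε : ℝ, 0 < ε → |ℓ z| ≤ ε * (‖z‖ + ε) + ‖ℓ‖ * ε by
    have hlim : Tendsto (fun ε : ℝ => ε * (‖z‖ + ε) + ‖ℓ‖ * ε) (𝓝[>] 0)
        (𝓝 (0 * (‖z‖ + 0) + ‖ℓ‖ * 0)) :=
      Tendsto.mono_left (Continuous.tendsto (by fun_prop) 0) nhdsWithin_le_nhds
    have := le_of_tendsto_of_tendsto tendsto_const_nhds hlim
      (by filter_upwards [self_mem_nhdsWithin] using H)
    simpa using this
  intro ε hε
  have h1 : ∀ᶠ r in 𝓝[>] (0 : ℝ), (s ∩ ({x} + r • closedBall z ε)).Nonempty :=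
    Measure.eventually_nonempty_inter_smul_of_density_one μ s x hx _ measurableSet_closedBall
      (measure_closedBall_pos μ z hε).ne'
  obtain ⟨ρ, ρpos, hρ⟩ : ∃ ρ > 0, ball x ρ ∩ s ⊆ {y : E | ‖ℓ (y - x)‖ ≤ ε * ‖y - x‖} :=
    mem_nhdsWithin_iff.1 (h.def hε)
  have h2 : ∀ᶠ r in 𝓝[>] (0 : ℝ), {x} + r • closedBall z ε ⊆ ball x ρ := by
    apply nhdsWithin_le_nhds
    exact eventually_singleton_add_smul_subset isBounded_closedBall (ball_mem_nhds x ρpos)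
  obtain ⟨r, ⟨y, ys, hy⟩, rρ, rpos⟩ := (h1.and (h2.and self_mem_nhdsWithin)).exists
  have rpos : 0 < r := rpos
  obtain ⟨a, az, rfl⟩ : ∃ a, a ∈ closedBall z ε ∧ y = x + r • a := by
    simp only [mem_smul_set, image_add_left, mem_preimage, singleton_add] at hy
    rcases hy with ⟨a, az, ha⟩
    exact ⟨a, az, by simp only [ha, add_neg_cancel_left]⟩
  have hza : ‖z - a‖ ≤ ε := by rw [norm_sub_rev]; exact mem_closedBall_iff_norm.1 az
  have ha : ‖a‖ ≤ ‖z‖ + ε := by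
    have := norm_sub_le z (z - a)
    rw [sub_sub_cancel] at this
    linarith
  have h3 : ‖ℓ (x + r • a - x)‖ ≤ ε * ‖x + r • a - x‖ := hρ ⟨rρ hy, ys⟩
  rw [add_sub_cancel_left, map_smul, norm_smul, norm_smul, Real.norm_of_nonneg rpos.le,
    mul_left_comm] at h3
  have h4 : ‖ℓ a‖ ≤ ε * ‖a‖ := le_of_mul_le_mul_left h3 rpos
  have h5 : ‖ℓ (z - a)‖ ≤ ‖ℓ‖ * ε := (ℓ.le_opNorm _).trans (by gcongr)
  calc |ℓ z| = ‖ℓ a + ℓ (z - a)‖ := by rw [← map_add, add_sub_cancel]; rfl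
    _ ≤ ‖ℓ a‖ + ‖ℓ (z - a)‖ := norm_add_le _ _
    _ ≤ ε * (‖z‖ + ε) + ‖ℓ‖ * ε := by
      refine add_le_add (h4.trans ?_) h5
      gcongr

end

theorem tendsto_setAverage_zero {X : Type*} [PseudoMetricSpace X] [ProperSpace X]
    [MeasurableSpace X] (μ : Measure X)
    [IsFiniteMeasureOnCompacts μ] {f : X → ℝ} {p : X} (hf : Tendsto f (𝓝 p) (𝓝 0)) (D : Set X) :
    Tendsto (fun r : ℝ => ⨍ q in ball p r ∩ D, f q ∂μ) (𝓝[>] 0) (𝓝 0) := by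
  rw [Metric.tendsto_nhds]
  intro ε hε
  have h1 : ∀ᶠ q in 𝓝 p, |f q| < ε / 2 := by
    have := (Metric.tendsto_nhds.1 hf) (ε / 2) (by positivity)
    simpa [Real.dist_eq] using this
  obtain ⟨ρ, hρ, hb⟩ := Metric.mem_nhds_iff.1 h1
  filter_upwards [Ioo_mem_nhdsGT hρ] with r hr
  rw [dist_zero_right, setAverage_eq, norm_smul]
  have hfin : μ (ball p r ∩ D) < ⊤ := (measure_mono inter_subset_left).trans_lt measure_ball_lt_top
  have h2 : ‖∫ q in ball p r ∩ D, f q ∂μ‖ ≤ ε / 2 * μ.real (ball p r ∩ D) := by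
    refine norm_setIntegral_le_of_norm_le_const hfin fun q hq => ?_
    exact (hb (ball_subset_ball hr.2.le hq.1)).le
  rw [norm_inv, Real.norm_of_nonneg measureReal_nonneg]
  calc (μ.real (ball p r ∩ D))⁻¹ * ‖∫ q in ball p r ∩ D, f q ∂μ‖
      ≤ (μ.real (ball p r ∩ D))⁻¹ * (ε / 2 * μ.real (ball p r ∩ D)) := by gcongr
    _ = ε / 2 * ((μ.real (ball p r ∩ D))⁻¹ * μ.real (ball p r ∩ D)) := by ring
    _ ≤ ε / 2 * 1 := by gcongr; exact inv_mul_le_one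
    _ < ε := by linarith

section
variable {n : ℕ} {β γ R : ℝ}

theorem hausdorffMeasure_eq_zero_of_volume_eq_zero {N : Set (EuclideanSpace ℝ (Fin n))}
    (hN : volume N = 0) : Measure.hausdorffMeasure (n : ℝ) N = 0 := by
  have h := isAddHaarMeasure_hausdorffMeasure (E := EuclideanSpace ℝ (Fin n))
  rw [finrank_euclideanSpace_fin] at h
  exact Measure.absolutelyContinuous_isAddHaarMeasure _ _ hN

/-- The parametrization of the interface by `x`. -/
def interface (n : ℕ) (β γ R : ℝ) (x : EuclideanSpace ℝ (Fin n)) : EuclideanSpace ℝ (Fin n) × ℝ :=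
  (x, barrier n β γ R (radius x))

theorem exists_lipschitzOnWith_interface (hn : 1 ≤ n) (hβ : 0 < β) (hR : 1 ≤ R) (m : ℝ) :
    ∃ K, LipschitzOnWith K (interface n β γ R) (closedBall 0 m) := by
  have hd : ∀ r ∈ Icc (1 : ℝ) (max m 1), HasDerivWithinAt (barrier n β γ R) _ (Icc 1 (max m 1)) r :=
    fun r hr => (hasDerivAt_barrier (γ := γ) hn hβ hR (one_pos.trans_le hr.1)).hasDerivWithinAt
  have hc := slopeConst_pos hn hβ hR
  obtain ⟨C, hC⟩ := (isCompact_Icc (a := (1 : ℝ)) (b := max m 1)).exists_bound_of_continuousOn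
    (f := fun r => (-((slopeConst n β R / r ^ (n - 1)) ^ 2 - γ ^ 2) /
      (2 * (slopeConst n β R / r ^ (n - 1))))) (by
      have hne : ∀ r ∈ Icc (1 : ℝ) (max m 1), r ≠ 0 := fun r hr => (one_pos.trans_le hr.1).ne'
      have h1 : ContinuousOn (fun r : ℝ => slopeConst n β R / r ^ (n - 1)) (Icc 1 (max m 1)) :=
        continuousOn_const.div (continuousOn_id.pow _) fun r hr => pow_ne_zero _ (hne r hr)
      refine ((h1.pow 2).sub continuousOn_const).neg.div (continuousOn_const.mul h1) fun r hr => ?_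
      have := one_pos.trans_le hr.1
      positivity)
  have hB : LipschitzOnWith C.toNNReal (barrier n β γ R) (Icc 1 (max m 1)) :=
    (convex_Icc _ _).lipschitzOnWith_of_nnnorm_hasDerivWithin_le hd fun r hr => by
      rw [← NNReal.coe_le_coe, coe_nnnorm]
      exact (hC r hr).trans (Real.le_coe_toNNReal C)
  have hr : LipschitzWith 1 (radius : EuclideanSpace ℝ (Fin n) → ℝ) :=
    lipschitzWith_one_norm.max_const 1
  refine ⟨max 1 (C.toNNReal * 1), LipschitzWith.id.lipschitzOnWith.prodMk
    (hB.comp hr.lipschitzOnWith fun x hx => ?_)⟩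
  exact ⟨one_le_radius x, max_le_max (by simpa using hx) le_rfl⟩

/-- Lebesgue-null sets of parameters give `ℋⁿ`-null subsets of the interface. -/
theorem hausdorffMeasure_interface_image_eq_zero (hn : 1 ≤ n) (hβ : 0 < β) (hR : 1 ≤ R)
    {N : Set (EuclideanSpace ℝ (Fin n))} (hN : volume N = 0) :
    Measure.hausdorffMeasure (n : ℝ) (interface n β γ R '' N) = 0 := by
  have : interface n β γ R '' N ⊆ ⋃ m : ℕ, interface n β γ R '' (N ∩ closedBall 0 m) := by
    rintro _ ⟨x, hx, rfl⟩
    obtain ⟨m, hm⟩ := exists_nat_ge ‖x‖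
    exact mem_iUnion.2 ⟨m, x, ⟨hx, by simpa using hm⟩, rfl⟩
  refine measure_mono_null this (measure_iUnion_null fun m => ?_)
  obtain ⟨K, hK⟩ := exists_lipschitzOnWith_interface (n := n) (γ := γ) hn hβ hR m
  have h0 : Measure.hausdorffMeasure (n : ℝ) (N ∩ closedBall 0 (m : ℝ)) = 0 :=
    hausdorffMeasure_eq_zero_of_volume_eq_zero (measure_mono_null inter_subset_left hN)
  have := (hK.mono (inter_subset_right (s := N))).hausdorffMeasure_image_le (Nat.cast_nonneg n)
  rw [h0, mul_zero] at this
  exact le_antisymm this bot_le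

/-- `q ↦ dot q ν` as a continuous linear form. -/
def dotCLM (ν : EuclideanSpace ℝ (Fin n) × ℝ) : EuclideanSpace ℝ (Fin n) × ℝ →L[ℝ] ℝ :=
  (innerSL ℝ ν.1).comp (ContinuousLinearMap.fst ℝ _ _) + ν.2 • ContinuousLinearMap.snd ℝ _ _

theorem dotCLM_apply (ν q : EuclideanSpace ℝ (Fin n) × ℝ) : dotCLM ν q = dot q ν := by
  simp [dotCLM, dot, real_inner_comm, mul_comm]

/-- If the points of the interface lying on `M` have Lebesgue density `1` (in the parametrization)
at `x`, every unit normal to `M` there is also normal to the interface, to which the field is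
tangent. -/
theorem dot_flow_eq_zero (hn : 1 ≤ n) (hβ : 0 < β) (hR : 1 ≤ R)
    {M : Set (EuclideanSpace ℝ (Fin n) × ℝ)} {x : EuclideanSpace ℝ (Fin n)} (hx : 1 < ‖x‖)
    (hdens : Tendsto (fun r => volume (interface n β γ R ⁻¹' M ∩ closedBall x r) /
      volume (closedBall x r)) (𝓝[>] 0) (𝓝 1))
    {ν : EuclideanSpace ℝ (Fin n) × ℝ} (hν : IsUnitNormalAt M (interface n β γ R x) ν) :
    dot (flow (slopeConst n β R) γ x) ν = 0 := by
  have hx0 : 0 < ‖x‖ := by linarith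
  have hc := slopeConst_pos hn hβ hR
  have hdn : DifferentiableAt ℝ (fun y : EuclideanSpace ℝ (Fin n) => ‖y‖) x :=
    differentiableAt_id.norm ℝ (norm_pos_iff.1 hx0)
  have hself := hdn.fderiv_norm_self
  set L := fderiv ℝ (fun y : EuclideanSpace ℝ (Fin n) => ‖y‖) x
  set b := -((slopeConst n β R / ‖x‖ ^ (n - 1)) ^ 2 - γ ^ 2) /
    (2 * (slopeConst n β R / ‖x‖ ^ (n - 1))) with hb
  have hB : HasFDerivAt (fun y : EuclideanSpace ℝ (Fin n) => barrier n β γ R (radius y))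
      (b • L) x := by
    refine ((hasDerivAt_barrier (γ := γ) hn hβ hR hx0).comp_hasFDerivAt x
      hdn.hasFDerivAt).congr_of_eventuallyEq ?_
    filter_upwards [continuous_norm.continuousAt.eventually (lt_mem_nhds hx)] with y hy
    simp [radius_of_one_le hy.le]
  have hG : HasFDerivAt (interface n β γ R)
      ((ContinuousLinearMap.id ℝ (EuclideanSpace ℝ (Fin n))).prod (b • L)) x :=
    (hasFDerivAt_id x).prodMk hB
  have htend : Tendsto (interface n β γ R) (𝓝[interface n β γ R ⁻¹' M] x)
      (𝓝[M] (interface n β γ R x)) :=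
    hG.continuousAt.continuousWithinAt.tendsto_nhdsWithin (mapsTo_preimage _ _)
  have h1 : (fun y => dotCLM ν (interface n β γ R y - interface n β γ R x))
      =o[𝓝[interface n β γ R ⁻¹' M] x] fun y => y - x := by
    have := (hν.2.comp_tendsto htend).trans_isBigO (hG.isBigO_sub.mono nhdsWithin_le_nhds)
    simp only [dotCLM_apply]
    exact this
  have h2 : (fun y => dotCLM ν (interface n β γ R y - interface n β γ R x -
      ((ContinuousLinearMap.id ℝ (EuclideanSpace ℝ (Fin n))).prod (b • L)) (y - x)))
      =o[𝓝[interface n β γ R ⁻¹' M] x] fun y => y - x :=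
    ((dotCLM ν).isBigO_comp _ _).trans_isLittleO (hG.isLittleO.mono nhdsWithin_le_nhds)
  have h3 := eq_zero_of_isLittleO_of_density volume hdens
    ((dotCLM ν).comp ((ContinuousLinearMap.id ℝ (EuclideanSpace ℝ (Fin n))).prod (b • L))) (by
      refine (h1.sub h2).congr_left fun y => ?_
      rw [← map_sub, sub_sub_cancel]; rfl)
  have h4 := congrArg (fun ℓ => ℓ x) h3
  simp only [ContinuousLinearMap.comp_apply, ContinuousLinearMap.prod_apply, dotCLM_apply, dot,
    ContinuousLinearMap.id_apply, smul_apply, hself,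
    zero_apply, smul_eq_mul] at h4
  have hp : ‖x‖ ^ n = ‖x‖ * ‖x‖ ^ (n - 1) := by rw [← pow_succ']; congr 1; omega
  have h5 : inner ℝ x ν.1 = - (b * ‖x‖ * ν.2) := by linarith
  simp only [dot, flow, radius_of_one_le hx.le]
  rw [inner_smul_left, h5, hb, hp]
  simp only [conj_trivial]
  field_simp
  ring

theorem continuousAt_calib (hn : 1 ≤ n) (hβ : 0 < β) (hR : 1 ≤ R)
    {p : EuclideanSpace ℝ (Fin n) × ℝ} (hp : p.2 ≠ barrier n β γ R (radius p.1)) :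
    ContinuousAt (calib β γ R) p := by
  have hB : ContinuousAt (fun q : EuclideanSpace ℝ (Fin n) × ℝ => barrier n β γ R (radius q.1)) p :=
    ((continuous_barrier_radius hn hβ hR).comp continuous_fst).continuousAt
  rcases lt_or_gt_of_ne hp with h | h
  · refine (continuousAt_const (y := (0 : EuclideanSpace ℝ (Fin n) × ℝ))).congr ?_
    filter_upwards [continuousAt_snd.eventually_lt hB h] with q hq
    simp [calib, hq.not_gt]
  · refine ((continuous_flow (slopeConst n β R) γ).comp continuous_fst).continuousAt.congr ?_
    filter_upwards [hB.eventually_lt continuousAt_snd h] with q hq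
    simp [calib, hq]

theorem isBoundedApproxRegular_calib (hn : 1 ≤ n) (hβ : 0 < β) (hR : 1 ≤ R) :
    IsBoundedApproxRegular ((ball (0 : EuclideanSpace ℝ (Fin n)) 1)ᶜ ×ˢ Icc (0 : ℝ) 1)
      (calib β γ R) := by
  refine ⟨⟨_, fun p _ => norm_calib_le hn hβ hR p⟩, fun M _ => ?_⟩
  have hdens := ae_imp_of_ae_restrict (Besicovitch.ae_tendsto_measure_inter_div
    (volume : Measure (EuclideanSpace ℝ (Fin n))) (interface n β γ R ⁻¹' M))
  have : Nonempty (Fin n) := ⟨⟨0, hn⟩⟩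
  have hsph : ∀ᵐ x : EuclideanSpace ℝ (Fin n), ‖x‖ ≠ 1 := by
    have := Measure.addHaar_sphere (volume : Measure (EuclideanSpace ℝ (Fin n))) 0 1
    filter_upwards [measure_eq_zero_iff_ae_notMem.1 this] with x hx
    simpa using hx
  -- `radius` is not differentiable on the unit sphere, a null set
  have hN := hausdorffMeasure_interface_image_eq_zero (γ := γ) hn hβ hR (hdens.and hsph)
  filter_upwards [measure_eq_zero_iff_ae_notMem.1 hN] with p hpN hp ν hν
  refine tendsto_setAverage_zero volume ?_ _
  by_cases hpB : p.2 = barrier n β γ R (radius p.1)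
  · have hpe : p = interface n β γ R p.1 := Prod.ext rfl hpB
    have hgood : (p.1 ∈ interface n β γ R ⁻¹' M → Tendsto (fun r =>
        volume (interface n β γ R ⁻¹' M ∩ closedBall p.1 r) / volume (closedBall p.1 r))
        (𝓝[>] 0) (𝓝 1)) ∧ ‖p.1‖ ≠ 1 := by
      by_contra h
      exact hpN ⟨p.1, h, hpe.symm⟩
    have hx1 : 1 ≤ ‖p.1‖ := by simpa using hp.2.1
    have hx : 1 < ‖p.1‖ := lt_of_le_of_ne hx1 hgood.2.symm
    have h0 := dot_flow_eq_zero hn hβ hR hx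
      (hgood.1 (by rw [mem_preimage, ← hpe]; exact hp.1)) (by rw [← hpe]; exact hν)
    have hp0 : calib β γ R p = 0 := by simp [calib, hpB]
    have hz : ∀ v : EuclideanSpace ℝ (Fin n) × ℝ, dot 0 v = 0 := fun v => by simp [dot]
    have hlim : Tendsto (fun q : EuclideanSpace ℝ (Fin n) × ℝ =>
        |dot (flow (slopeConst n β R) γ q.1) ν|) (𝓝 p) (𝓝 0) := by
      have : Continuous fun q : EuclideanSpace ℝ (Fin n) × ℝ =>
          |dotCLM ν (flow (slopeConst n β R) γ q.1)| :=
        ((dotCLM ν).continuous.comp ((continuous_flow _ _).comp continuous_fst)).abs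
      have := this.tendsto p
      simpa only [dotCLM_apply, h0, abs_zero] using this
    refine squeeze_zero (fun q => abs_nonneg _) (fun q => ?_) hlim
    rw [hp0, hz, sub_zero]
    unfold calib
    split_ifs
    · exact le_rfl
    · rw [hz, abs_zero]; exact abs_nonneg _
  · have hcont := continuousAt_calib hn hβ hR hpB
    have h1 : ContinuousAt (fun q => |dotCLM ν (calib β γ R q) - dotCLM ν (calib β γ R p)|) p :=
      (((dotCLM ν).continuous.continuousAt.comp hcont).sub continuousAt_const).abs
    have := h1.tendsto
    simpa only [dotCLM_apply, sub_self, abs_zero] using this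

end

/-! ### The jump set -/

section
variable {n : ℕ}

/-- The half ball of centre `x` and radius `r` in the direction `ν`. -/
def halfBall (x : EuclideanSpace ℝ (Fin n)) (r : ℝ) (ν : EuclideanSpace ℝ (Fin n)) :
    Set (EuclideanSpace ℝ (Fin n)) :=
  ball x r ∩ {y | 0 < inner ℝ (y - x) ν}

theorem isOpen_halfBall (x : EuclideanSpace ℝ (Fin n)) (r : ℝ) (ν : EuclideanSpace ℝ (Fin n)) :
    IsOpen (halfBall x r ν) := by
  refine isOpen_ball.inter (isOpen_lt continuous_const ?_)
  fun_prop

theorem halfBall_neg (x : EuclideanSpace ℝ (Fin n)) (r : ℝ) (ν : EuclideanSpace ℝ (Fin n)) :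
    ball x r ∩ {y | inner ℝ (y - x) ν < 0} = halfBall x r (-ν) := by
  simp [halfBall]

theorem volume_halfBall_lt_top (x : EuclideanSpace ℝ (Fin n)) (r : ℝ)
    (ν : EuclideanSpace ℝ (Fin n)) : volume (halfBall x r ν) < ⊤ :=
  (measure_mono inter_subset_left).trans_lt measure_ball_lt_top

theorem setIntegral_halfBall (f : EuclideanSpace ℝ (Fin n) → ℝ) (x ν : EuclideanSpace ℝ (Fin n))
    {r : ℝ} (hr : 0 < r) :
    ∫ y in halfBall x r ν, f y = r ^ n * ∫ z in halfBall 0 1 ν, f (x + r • z) := by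
  rw [← integral_indicator (isOpen_halfBall _ _ _).measurableSet,
    ← integral_indicator (isOpen_halfBall _ _ _).measurableSet]
  have h1 := Measure.integral_comp_smul (volume : Measure (EuclideanSpace ℝ (Fin n)))
    (fun z => (halfBall x r ν).indicator f (x + z)) r
  rw [integral_add_left_eq_self ((halfBall x r ν).indicator f) x, finrank_euclideanSpace_fin,
    abs_of_pos (by positivity), smul_eq_mul] at h1
  have h2 : ∀ z, (halfBall x r ν).indicator f (x + r • z) =
      (halfBall 0 1 ν).indicator (fun z => f (x + r • z)) z := by
    intro z
    have : x + r • z ∈ halfBall x r ν ↔ z ∈ halfBall 0 1 ν := by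
      simp only [halfBall, mem_inter_iff, mem_ball, dist_self_add_left, mem_ofPred_eq,
        add_sub_cancel_left, norm_smul, Real.norm_of_nonneg hr.le, inner_smul_left, conj_trivial,
        dist_zero_right, sub_zero, mul_pos_iff_of_pos_left hr]
      rw [mul_lt_iff_lt_one_right hr]
    by_cases hz : z ∈ halfBall 0 1 ν
    · rw [indicator_of_mem (this.2 hz), indicator_of_mem hz]
    · rw [indicator_of_notMem (mt this.1 hz), indicator_of_notMem hz]
  simp only [h2] at h1
  rw [h1]
  field_simp

theorem setAverage_halfBall (f : EuclideanSpace ℝ (Fin n) → ℝ) (x ν : EuclideanSpace ℝ (Fin n))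
    {r : ℝ} (hr : 0 < r) :
    ⨍ y in halfBall x r ν, f y = ⨍ z in halfBall 0 1 ν, f (x + r • z) := by
  have h := setIntegral_halfBall (fun _ => 1) x ν hr
  simp only [setIntegral_const, smul_eq_mul, mul_one] at h
  rw [setAverage_eq, setAverage_eq, h, setIntegral_halfBall f x ν hr, smul_eq_mul, smul_eq_mul,
    mul_inv, mul_assoc, mul_left_comm (volume.real _)⁻¹, inv_mul_cancel_left₀ (by positivity)]

/-- Averages over shrinking half balls converge to the average of the blow-up limit `w`. -/
theorem tendsto_setAverage_halfBall {u w : EuclideanSpace ℝ (Fin n) → ℝ} (hu : Measurable u)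
    {C : ℝ} (hC : ∀ y, |u y| ≤ C) {x : EuclideanSpace ℝ (Fin n)}
    (hw : ∀ᵐ z, Tendsto (fun r : ℝ => u (x + r • z)) (𝓝[>] 0) (𝓝 (w z)))
    (ν : EuclideanSpace ℝ (Fin n)) (b : ℝ) :
    Tendsto (fun r : ℝ => ⨍ y in halfBall x r ν, |u y - b|) (𝓝[>] 0)
      (𝓝 (⨍ z in halfBall 0 1 ν, |w z - b|)) := by
  have h1 : Tendsto (fun r : ℝ => ⨍ z in halfBall 0 1 ν, |u (x + r • z) - b|) (𝓝[>] 0)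
      (𝓝 (⨍ z in halfBall 0 1 ν, |w z - b|)) := by
    simp only [setAverage_eq]
    refine Tendsto.const_smul ?_ _
    have hfin : IsFiniteMeasure (volume.restrict (halfBall (0 : EuclideanSpace ℝ (Fin n)) 1 ν)) :=
      ⟨by rw [Measure.restrict_apply_univ]; exact volume_halfBall_lt_top _ _ _⟩
    refine tendsto_integral_filter_of_dominated_convergence (fun _ => C + |b|) ?_ ?_
      (integrable_const _) ?_
    · refine Eventually.of_forall fun r => Measurable.aestronglyMeasurable ?_
      have : Measurable fun z : EuclideanSpace ℝ (Fin n) => u (x + r • z) :=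
        hu.comp (by fun_prop)
      fun_prop
    · refine Eventually.of_forall fun r => Eventually.of_forall fun z => ?_
      rw [Real.norm_eq_abs, abs_abs]
      exact (abs_sub _ _).trans (by gcongr; exact hC _)
    · filter_upwards [ae_restrict_of_ae hw] with z hz
      exact (hz.sub_const b).abs
  refine h1.congr' ?_
  filter_upwards [self_mem_nhdsWithin] with r hr
  rw [setAverage_halfBall _ x ν hr]

theorem eq_of_setAverage_eq_zero {w : EuclideanSpace ℝ (Fin n) → ℝ} (hw : Measurable w)
    {C : ℝ} (hC : ∀ y, |w y| ≤ C) {ν : EuclideanSpace ℝ (Fin n)} {b d : ℝ}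
    (h : ⨍ z in halfBall 0 1 ν, |w z - b| = 0) {z : EuclideanSpace ℝ (Fin n)} (hz : ‖z‖ < 1)
    (hzν : 0 < inner ℝ z ν) (hd : ∀ᶠ y in 𝓝 z, w y = d) : d = b := by
  have hmem : halfBall 0 1 ν ∈ 𝓝 z :=
    (isOpen_halfBall _ _ _).mem_nhds ⟨by simpa using hz, by simpa using hzν⟩
  have hfin := volume_halfBall_lt_top (0 : EuclideanSpace ℝ (Fin n)) 1 ν
  have hpos : volume.real (halfBall (0 : EuclideanSpace ℝ (Fin n)) 1 ν) ≠ 0 := by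
    rw [measureReal_def, ENNReal.toReal_ne_zero]
    exact ⟨(Measure.measure_pos_of_mem_nhds _ hmem).ne', hfin.ne⟩
  rw [setAverage_eq, smul_eq_mul, mul_eq_zero, or_iff_right (inv_ne_zero hpos)] at h
  have hint : IntegrableOn (fun z => |w z - b|) (halfBall 0 1 ν) :=
    IntegrableOn.of_bound hfin (hw.sub_const b).abs.aestronglyMeasurable (C + |b|)
      (Eventually.of_forall fun y => by
        rw [Real.norm_eq_abs, abs_abs]
        exact (abs_sub _ _).trans (by gcongr; exact hC _))
  rw [setIntegral_eq_zero_iff_of_nonneg_ae (Eventually.of_forall fun y => abs_nonneg _) hint] at h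
  by_contra hne
  have hnull : volume (halfBall 0 1 ν ∩ {y | w y = d}) = 0 := by
    have h2 := (ae_restrict_iff' (isOpen_halfBall _ _ _).measurableSet).1 h
    refine measure_mono_null (fun y hy => ?_) (ae_iff.1 h2)
    simp only [mem_ofPred_eq, Pi.zero_apply, abs_eq_zero, Classical.not_imp]
    exact ⟨hy.1, by rw [hy.2]; exact sub_ne_zero.2 hne⟩
  exact (Measure.measure_pos_of_mem_nhds _ (inter_mem hmem hd)).ne' hnull

/-- One-sided approximate limits are determined by the blow-up limit. -/
theorem IsJump.eq_of_blowup {u w : EuclideanSpace ℝ (Fin n) → ℝ} (hu : Measurable u)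
    {C : ℝ} (hC : ∀ y, |u y| ≤ C) {x : EuclideanSpace ℝ (Fin n)} (hwm : Measurable w)
    (hwC : ∀ y, |w y| ≤ C)
    (hw : ∀ᵐ z, Tendsto (fun r : ℝ => u (x + r • z)) (𝓝[>] 0) (𝓝 (w z)))
    {a b : ℝ} {ν : EuclideanSpace ℝ (Fin n)} (h : IsJump u x a b ν)
    {z : EuclideanSpace ℝ (Fin n)} {d : ℝ} (hz : ‖z‖ < 1) (hd : ∀ᶠ y in 𝓝 z, w y = d) :
    (0 < inner ℝ z ν → d = b) ∧ (inner ℝ z ν < 0 → d = a) := by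
  obtain ⟨-, -, h1, h2⟩ := h
  simp only [halfBall_neg] at h2
  constructor
  · intro hzν
    exact eq_of_setAverage_eq_zero hwm hwC
      (tendsto_nhds_unique (tendsto_setAverage_halfBall hu hC hw ν b) h1) hz hzν hd
  · intro hzν
    exact eq_of_setAverage_eq_zero hwm hwC
      (tendsto_nhds_unique (tendsto_setAverage_halfBall hu hC hw (-ν) a) h2) hz
      (by simpa using hzν) hd

end

section
variable {n : ℕ} {β R : ℝ} {x : EuclideanSpace ℝ (Fin n)}

theorem radialU_eq (hR : 1 ≤ R) (x : EuclideanSpace ℝ (Fin n)) :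
    radialU n β R x = if ‖x‖ ≤ R then 1 - slopeConst n β R * Gam n (radius x) else 0 := by
  unfold radialU
  by_cases h1 : ‖x‖ ≤ 1
  · simp [h1, h1.trans hR, radius, Gam_one]
  · simp [h1, radius_of_one_le (not_le.1 h1).le, slopeConst]

theorem measurable_radialU (hR : 1 ≤ R) : Measurable (radialU n β R) := by
  have : radialU n β R =
      fun x => if ‖x‖ ≤ R then 1 - slopeConst n β R * Gam n (radius x) else 0 :=
    funext (radialU_eq hR)
  rw [this]
  refine Measurable.ite (measurableSet_le measurable_norm measurable_const) ?_ measurable_const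
  exact (((measurable_Gam n).comp continuous_radius.measurable).const_mul _).const_sub _

theorem radialU_mem_Icc (hn : 1 ≤ n) (hβ : 0 < β) (hR : 1 ≤ R) (x : EuclideanSpace ℝ (Fin n)) :
    0 ≤ radialU n β R x ∧ radialU n β R x ≤ 1 := by
  have hc := slopeConst_pos hn hβ hR
  rw [radialU_eq hR]
  split_ifs with h
  · have h1 := Gam_nonneg hn (one_le_radius x)
    have h2 : Gam n (radius x) ≤ Gam n R :=
      Gam_mono hn (one_pos.trans_le (one_le_radius x)) (max_le h hR)
    have h3 := one_sub_slopeConst_mul_Gam hn hβ hR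
    have h4 := delta_pos hn hβ hR
    have h5 : slopeConst n β R * Gam n (radius x) ≤ slopeConst n β R * Gam n R := by gcongr
    have h6 := mul_nonneg hc.le h1
    constructor <;> linarith
  · simp

theorem continuous_profile (hn : 1 ≤ n) :
    Continuous fun x : EuclideanSpace ℝ (Fin n) => 1 - slopeConst n β R * Gam n (radius x) := by
  have : Continuous fun x : EuclideanSpace ℝ (Fin n) => Gam n (radius x) :=
    continuous_iff_continuousAt.2 fun x =>
      (hasDerivAt_Gam hn (one_pos.trans_le (one_le_radius x))).continuousAt.comp
        continuous_radius.continuousAt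
  fun_prop

theorem continuousAt_radialU (hn : 1 ≤ n) (hR : 1 ≤ R) (hx : ‖x‖ ≠ R) :
    ContinuousAt (radialU n β R) x := by
  rcases lt_or_gt_of_ne hx with h | h
  · refine (continuous_profile (β := β) (R := R) hn).continuousAt.congr ?_
    filter_upwards [continuous_norm.continuousAt.eventually (gt_mem_nhds h)] with y hy
    rw [radialU_eq hR, if_pos (le_of_lt hy)]
  · refine (continuousAt_const (y := (0 : ℝ))).congr ?_
    filter_upwards [continuous_norm.continuousAt.eventually (lt_mem_nhds h)] with y hy
    rw [radialU_eq hR, if_neg (not_le.2 hy)]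

/-- The blow-up limit of `u` at a point `x` of the sphere `|x| = R`: a two-valued step function. -/
def stepU (n : ℕ) (β R : ℝ) (x z : EuclideanSpace ℝ (Fin n)) : ℝ :=
  if 0 < inner ℝ z (-R⁻¹ • x) then delta n β R else 0

theorem measurable_stepU (x : EuclideanSpace ℝ (Fin n)) : Measurable (stepU n β R x) := by
  refine Measurable.ite (measurableSet_lt measurable_const ?_) measurable_const measurable_const
  exact Continuous.measurable (by fun_prop)

theorem stepU_eventuallyEq_delta {z : EuclideanSpace ℝ (Fin n)}
    (hz : 0 < inner ℝ z (-R⁻¹ • x)) : ∀ᶠ y in 𝓝 z, stepU n β R x y = delta n β R := by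
  have : Continuous fun y : EuclideanSpace ℝ (Fin n) => inner ℝ y (-R⁻¹ • x) := by fun_prop
  filter_upwards [this.continuousAt.eventually (lt_mem_nhds hz)] with y hy
  simp only [stepU, if_pos hy]

theorem stepU_eventuallyEq_zero {z : EuclideanSpace ℝ (Fin n)}
    (hz : inner ℝ z (-R⁻¹ • x) < 0) : ∀ᶠ y in 𝓝 z, stepU n β R x y = 0 := by
  have : Continuous fun y : EuclideanSpace ℝ (Fin n) => inner ℝ y (-R⁻¹ • x) := by fun_prop
  filter_upwards [this.continuousAt.eventually (gt_mem_nhds hz)] with y hy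
  simp only [stepU, if_neg (not_lt.2 (le_of_lt hy))]

theorem tendsto_radialU_stepU (hn : 1 ≤ n) (hβ : 0 < β) (hR : 1 ≤ R) (hx : ‖x‖ = R) :
    ∀ᵐ z, Tendsto (fun r : ℝ => radialU n β R (x + r • z)) (𝓝[>] 0) (𝓝 (stepU n β R x z)) := by
  have hR0 : 0 < R := by linarith
  have hx0 : x ≠ 0 := norm_pos_iff.1 (by rw [hx]; exact hR0)
  have hplane : ∀ᵐ z : EuclideanSpace ℝ (Fin n), inner ℝ x z ≠ 0 := by
    have h := Measure.addHaar_submodule (volume : Measure (EuclideanSpace ℝ (Fin n)))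
      (LinearMap.ker (innerSL ℝ x).toLinearMap) (by
        intro htop
        have : x ∈ LinearMap.ker (innerSL ℝ x).toLinearMap := by rw [htop]; trivial
        simp [hx0] at this)
    filter_upwards [measure_eq_zero_iff_ae_notMem.1 h] with z hz
    simpa using hz
  filter_upwards [hplane] with z hz
  have hin : inner ℝ z (-R⁻¹ • x) = -(R⁻¹ * inner ℝ x z) := by
    rw [inner_smul_right, real_inner_comm]; ring
  have hsq : ∀ r : ℝ, ‖x + r • z‖ ^ 2 = R ^ 2 + r * (2 * inner ℝ x z + r * ‖z‖ ^ 2) := by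
    intro r
    rw [norm_add_sq_real, norm_smul, inner_smul_right, hx, mul_pow, Real.norm_eq_abs, sq_abs]
    ring
  rcases lt_or_gt_of_ne hz with h | h
  · have h0 : 0 < inner ℝ z (-R⁻¹ • x) := by
      rw [hin, neg_pos]
      exact mul_neg_of_pos_of_neg (by positivity) h
    have hval : stepU n β R x z = 1 - slopeConst n β R * Gam n (radius x) := by
      rw [stepU, if_pos h0, radius_of_one_le (by rw [hx]; exact hR), hx,
        one_sub_slopeConst_mul_Gam hn hβ hR]
    rw [hval]
    have hlim : Tendsto (fun r : ℝ => 1 - slopeConst n β R * Gam n (radius (x + r • z))) (𝓝[>] 0)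
        (𝓝 (1 - slopeConst n β R * Gam n (radius x))) := by
      have hline : Continuous fun r : ℝ => x + r • z := by fun_prop
      have := (((continuous_profile (β := β) (R := R) hn).comp hline).tendsto 0).mono_left
        (nhdsWithin_le_nhds (s := Ioi 0))
      simpa [Function.comp_def] using this
    refine hlim.congr' ?_
    have hneg : ∀ᶠ r : ℝ in 𝓝[>] 0, 2 * inner ℝ x z + r * ‖z‖ ^ 2 < 0 := by
      have : Continuous fun r : ℝ => 2 * inner ℝ x z + r * ‖z‖ ^ 2 := by fun_prop
      refine nhdsWithin_le_nhds (this.continuousAt.eventually (gt_mem_nhds ?_))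
      linarith
    filter_upwards [hneg, self_mem_nhdsWithin] with r hr hr0
    have hr0 : 0 < r := hr0
    have : ‖x + r • z‖ ^ 2 ≤ R ^ 2 := by
      rw [hsq]; nlinarith
    rw [radialU_eq hR, if_pos (le_of_sq_le_sq this hR0.le)]
  · have h0 : ¬ 0 < inner ℝ z (-R⁻¹ • x) := by
      rw [hin, not_lt, neg_nonpos]
      positivity
    rw [stepU, if_neg h0]
    refine tendsto_const_nhds.congr' ?_
    filter_upwards [self_mem_nhdsWithin] with r hr0
    have hr0 : 0 < r := hr0
    have : R ^ 2 < ‖x + r • z‖ ^ 2 := by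
      rw [hsq]
      have : 0 < r * (2 * inner ℝ x z + r * ‖z‖ ^ 2) := by positivity
      linarith
    rw [radialU_eq hR, if_neg (not_le.2 (lt_of_pow_lt_pow_left₀ 2 (norm_nonneg _) this))]

theorem abs_radialU_le (hn : 1 ≤ n) (hβ : 0 < β) (hR : 1 ≤ R) (x : EuclideanSpace ℝ (Fin n)) :
    |radialU n β R x| ≤ 1 := by
  have := radialU_mem_Icc hn hβ hR x
  rw [abs_of_nonneg this.1]; exact this.2

/-- Every point of the sphere `|x| = R` is a jump point; the normal points inwards. -/
theorem isJump_radialU (hn : 1 ≤ n) (hβ : 0 < β) (hR : 1 ≤ R) (hx : ‖x‖ = R) :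
    IsJump (radialU n β R) x 0 (delta n β R) (-R⁻¹ • x) := by
  have hR0 : 0 < R := by linarith
  have hlim := tendsto_radialU_stepU hn hβ hR hx
  have havg : ∀ (ν : EuclideanSpace ℝ (Fin n)) (b : ℝ),
      (∀ z, 0 < inner ℝ z ν → stepU n β R x z = b) →
      ⨍ z in halfBall 0 1 ν, |stepU n β R x z - b| = 0 := by
    intro ν b h
    rw [setAverage_eq, setIntegral_eq_zero_of_forall_eq_zero, smul_zero]
    intro z hz
    rw [h z (by simpa using hz.2), sub_self, abs_zero]
  refine ⟨delta_pos hn hβ hR, ?_, ?_, ?_⟩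
  · rw [norm_smul, hx, norm_neg, norm_inv, Real.norm_of_nonneg hR0.le, inv_mul_cancel₀ hR0.ne']
  · have := tendsto_setAverage_halfBall (measurable_radialU hR) (abs_radialU_le hn hβ hR) hlim
      (-R⁻¹ • x) (delta n β R)
    rwa [havg _ _ fun z hz => by rw [stepU, if_pos hz]] at this
  · simp only [halfBall_neg]
    have := tendsto_setAverage_halfBall (measurable_radialU hR) (abs_radialU_le hn hβ hR) hlim
      (-(-R⁻¹ • x)) 0
    rwa [havg _ _ fun z hz => by
      rw [inner_neg_right, neg_pos] at hz
      rw [stepU, if_neg hz.not_gt]] at this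

/-- There are no jump points off the sphere `|x| = R`, and on it the traces and the normal are
unique. -/
theorem IsJump.radialU_eq (hn : 1 ≤ n) (hβ : 0 < β) (hR : 1 ≤ R) {a b : ℝ}
    {ν : EuclideanSpace ℝ (Fin n)} (h : IsJump (radialU n β R) x a b ν) :
    ‖x‖ = R ∧ a = 0 ∧ b = delta n β R ∧ ν = -R⁻¹ • x := by
  have hu := measurable_radialU (n := n) (β := β) hR
  have hC := abs_radialU_le (n := n) hn hβ hR
  have hab := h.1
  have hν := h.2.1
  have hνν : inner ℝ ν ν = (1 : ℝ) := by rw [real_inner_self_eq_norm_sq, hν]; norm_num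
  have hxR : ‖x‖ = R := by
    by_contra hx
    have hw : ∀ᵐ z : EuclideanSpace ℝ (Fin n), Tendsto (fun r : ℝ => radialU n β R (x + r • z))
        (𝓝[>] 0) (𝓝 (radialU n β R x)) := Eventually.of_forall fun z => by
      have hline : Tendsto (fun r : ℝ => x + r • z) (𝓝[>] 0) (𝓝 x) := by
        have : Continuous fun r : ℝ => x + r • z := by fun_prop
        simpa using (this.tendsto 0).mono_left (nhdsWithin_le_nhds (s := Ioi 0))
      exact (continuousAt_radialU hn hR hx).tendsto.comp hline
    have hz : ‖(1 / 2 : ℝ) • ν‖ < 1 := by rw [norm_smul, hν]; norm_num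
    have hz' : ‖-((1 / 2 : ℝ) • ν)‖ < 1 := by rwa [norm_neg]
    have h1 := (h.eq_of_blowup hu hC measurable_const (fun _ => hC x) hw hz
      (d := radialU n β R x) (Eventually.of_forall fun _ => rfl)).1 (by
        rw [inner_smul_left, hνν]; norm_num)
    have h2 := (h.eq_of_blowup hu hC measurable_const (fun _ => hC x) hw hz'
      (d := radialU n β R x) (Eventually.of_forall fun _ => rfl)).2 (by
        rw [inner_neg_left, inner_smul_left, hνν]; norm_num)
    linarith
  refine ⟨hxR, ?_⟩
  have hδ := delta_pos hn hβ hR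
  have hjump := isJump_radialU hn hβ hR hxR
  have hδ1 : delta n β R ≤ 1 := by
    have := one_sub_slopeConst_mul_Gam hn hβ hR
    have := mul_nonneg (slopeConst_pos hn hβ hR).le (Gam_nonneg hn hR)
    linarith
  have hw := tendsto_radialU_stepU hn hβ hR hxR
  have hwC : ∀ y, |stepU n β R x y| ≤ 1 := by
    intro y
    unfold stepU
    split_ifs
    · rwa [abs_of_pos hδ]
    · simp
  set ν₀ := -R⁻¹ • x with hν₀
  have hn0 : ‖ν₀‖ = 1 := hjump.2.1
  have hν₀ν₀ : inner ℝ ν₀ ν₀ = (1 : ℝ) := by rw [real_inner_self_eq_norm_sq, hn0]; norm_num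
  have key := fun (z : EuclideanSpace ℝ (Fin n)) (hz : ‖z‖ < 1) (d : ℝ) hd =>
    h.eq_of_blowup hu hC (measurable_stepU x) hwC hw (z := z) (d := d) hz hd
  have hsmall : ∀ z : EuclideanSpace ℝ (Fin n), ‖z‖ ≤ 2 → ‖(1 / 4 : ℝ) • z‖ < 1 := by
    intro z hz
    rw [norm_smul, Real.norm_of_nonneg (by norm_num)]
    linarith
  have hcs : ∀ μ : EuclideanSpace ℝ (Fin n), ‖μ‖ = 1 → μ ≠ ν → inner ℝ μ ν < (1 : ℝ) := by
    intro μ hμ hne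
    exact lt_of_le_of_ne (by simpa [hμ, hν] using real_inner_le_norm μ ν)
      fun h => hne ((inner_eq_one_iff_of_norm_eq_one hμ hν).1 h)
  have hνeq : ν = ν₀ := by
    by_contra hne
    have hlt := hcs ν₀ hn0 (Ne.symm hne)
    have hle : ‖ν - ν₀‖ ≤ 2 := (norm_sub_le _ _).trans (by rw [hν, hn0]; norm_num)
    have hle' : ‖ν₀ - ν‖ ≤ 2 := by rwa [norm_sub_rev]
    -- `ν - ν₀` points to the `b` side but out of the ball, and `ν₀ - ν` to the `a` side but into
    -- it: this forces `b = 0 < δ = a`, against `a < b`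
    have hb := (key _ (hsmall _ hle) 0 (stepU_eventuallyEq_zero (by
      rw [inner_smul_left, inner_sub_left, ← hν₀, hν₀ν₀, real_inner_comm]
      simp only [conj_trivial]; linarith))).1 (by
      rw [inner_smul_left, inner_sub_left, hνν]
      simp only [conj_trivial]; linarith)
    have ha := (key _ (hsmall _ hle') _ (stepU_eventuallyEq_delta (by
      rw [inner_smul_left, inner_sub_left, ← hν₀, hν₀ν₀, real_inner_comm ν₀ ν]
      simp only [conj_trivial]; linarith))).2 (by
      rw [inner_smul_left, inner_sub_left, hνν]
      simp only [conj_trivial]; linarith)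
    linarith
  have hz : ‖(1 / 4 : ℝ) • ν‖ < 1 := hsmall _ (by rw [hν]; norm_num)
  have hz' : ‖-((1 / 4 : ℝ) • ν)‖ < 1 := by rwa [norm_neg]
  have hb := (key _ hz _ (stepU_eventuallyEq_delta (by
    rw [← hν₀, ← hνeq, inner_smul_left, hνν]; norm_num))).1 (by
    rw [inner_smul_left, hνν]; norm_num)
  have ha := (key _ hz' _ (stepU_eventuallyEq_zero (by
    rw [← hν₀, ← hνeq, inner_neg_left, inner_smul_left, hνν]; norm_num))).2 (by
    rw [inner_neg_left, inner_smul_left, hνν]; norm_num)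
  exact ⟨ha.symm, hb.symm, hνeq⟩

end

/-! ### Integration by parts and the distributional derivative of `u` -/

section
variable {n : ℕ}

theorem lineDeriv_comp_norm {h : ℝ → ℝ} {h' : ℝ} {x : EuclideanSpace ℝ (Fin n)} (hx : x ≠ 0)
    (hh : HasDerivAt h h' ‖x‖) (v : EuclideanSpace ℝ (Fin n)) :
    lineDeriv ℝ (fun y : EuclideanSpace ℝ (Fin n) => h ‖y‖) x v = h' * (inner ℝ x v / ‖x‖) := by
  have hx0 : ‖x‖ ≠ 0 := norm_ne_zero_iff.2 hx
  have h1 : HasDerivAt (fun t : ℝ => x + t • v) v 0 := by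
    simpa using ((hasDerivAt_id (0 : ℝ)).smul_const v).const_add x
  have h2 := h1.norm_sq
  have h3 := h2.sqrt (by simpa using hx0)
  have h4 : HasDerivAt (fun t : ℝ => ‖x + t • v‖) (inner ℝ x v / ‖x‖) 0 := by
    refine (h3.congr_deriv ?_).congr_of_eventuallyEq (Eventually.of_forall fun t => ?_)
    · simp only [zero_smul, add_zero, Real.sqrt_sq (norm_nonneg _)]
      field_simp
    · simp [Real.sqrt_sq (norm_nonneg _)]
  have h5 : HasDerivAt h h' ‖x + (0 : ℝ) • v‖ := by simpa using hh
  exact (h5.comp 0 h4).deriv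

theorem ae_norm_ne (hn : 1 ≤ n) (a : ℝ) : ∀ᵐ x : EuclideanSpace ℝ (Fin n), ‖x‖ ≠ a := by
  have : Nonempty (Fin n) := ⟨⟨0, hn⟩⟩
  have := Measure.addHaar_sphere (volume : Measure (EuclideanSpace ℝ (Fin n))) 0 a
  filter_upwards [measure_eq_zero_iff_ae_notMem.1 this] with x hx
  simpa using hx

/-- Integration by parts for a Lipschitz radial function with piecewise derivative. -/
theorem integral_comp_norm_mul_fderiv (hn : 1 ≤ n) {h h' : ℝ → ℝ} {K : ℝ≥0} (hK : LipschitzWith K h)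
    (a b : ℝ) (hh : ∀ r, 0 < r → r ≠ a → r ≠ b → HasDerivAt h (h' r) r)
    {ψ : EuclideanSpace ℝ (Fin n) → ℝ} (hψ : ContDiff ℝ ∞ ψ) (hψc : HasCompactSupport ψ)
    (v : EuclideanSpace ℝ (Fin n)) :
    ∫ x, h ‖x‖ * fderiv ℝ ψ x v = -∫ x, ψ x * (h' ‖x‖ * (inner ℝ x v / ‖x‖)) := by
  obtain ⟨D, hD⟩ := (hψ.of_le (by simp : (1 : WithTop ℕ∞) ≤ ∞)).lipschitzWith_of_hasCompactSupport
    hψc one_ne_zero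
  have hL : LipschitzWith (K * 1) fun x : EuclideanSpace ℝ (Fin n) => h ‖x‖ :=
    hK.comp lipschitzWith_one_norm
  have key := hL.integral_lineDeriv_mul_eq (μ := volume) hD hψc v
  have h1 : ∫ x, lineDeriv ℝ (fun x : EuclideanSpace ℝ (Fin n) => h ‖x‖) x v * ψ x =
      ∫ x, ψ x * (h' ‖x‖ * (inner ℝ x v / ‖x‖)) := by
    refine integral_congr_ae ?_
    filter_upwards [ae_norm_ne hn 0, ae_norm_ne hn a, ae_norm_ne hn b] with x h0 ha hb
    have hx : x ≠ 0 := norm_ne_zero_iff.1 h0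
    rw [lineDeriv_comp_norm hx (hh _ (norm_pos_iff.2 hx) ha hb), mul_comm]
  have h2 : ∫ x, lineDeriv ℝ ψ x (-v) * h ‖x‖ = -∫ x, h ‖x‖ * fderiv ℝ ψ x v := by
    rw [← integral_neg]
    congr 1; ext x
    rw [((hψ.differentiable (by simp)) x).lineDeriv_eq_fderiv, map_neg]
    ring
  rw [← h1, key, h2, neg_neg]

/-- The Lipschitz cutoff `1` on `r ≤ R`, `0` on `r ≥ R + ε`, affine in between. -/
def cutoff (R ε r : ℝ) : ℝ := max 0 (min 1 (1 - ε⁻¹ * (r - R)))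

theorem lipschitzWith_cutoff (R ε : ℝ) : ∃ K, LipschitzWith K (cutoff R ε) := by
  have h1 : LipschitzWith ‖ε⁻¹‖₊ fun r : ℝ => ε⁻¹ * r :=
    LipschitzWith.of_dist_le_mul fun x y => by
      rw [Real.dist_eq, Real.dist_eq, ← mul_sub, abs_mul]; rfl
  have h2 : LipschitzWith (0 + ‖ε⁻¹‖₊ * (1 + 0)) fun r : ℝ => 1 - ε⁻¹ * (r - R) :=
    (LipschitzWith.const 1).sub (h1.comp (LipschitzWith.id.sub (LipschitzWith.const R)))
  exact ⟨_, (h2.const_min 1).const_max 0⟩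

theorem hasDerivAt_cutoff {R ε r : ℝ} (hε : 0 < ε) (h1 : r ≠ R) (h2 : r ≠ R + ε) :
    HasDerivAt (cutoff R ε) ((Ioo R (R + ε)).indicator (fun _ => -ε⁻¹) r) r := by
  rcases lt_or_gt_of_ne h1 with h | h
  · rw [indicator_of_notMem fun hr => h.not_gt hr.1]
    refine (hasDerivAt_const r (1 : ℝ)).congr_of_eventuallyEq ?_
    filter_upwards [gt_mem_nhds h] with s hs
    have : ε⁻¹ * (s - R) ≤ 0 := mul_nonpos_of_nonneg_of_nonpos (by positivity) (by linarith)
    rw [cutoff, min_eq_left (by linarith), max_eq_right zero_le_one]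
  rcases lt_or_gt_of_ne h2 with h' | h'
  · rw [indicator_of_mem (show r ∈ Ioo R (R + ε) from ⟨h, h'⟩)]
    have hd : HasDerivAt (fun r : ℝ => 1 - ε⁻¹ * (r - R)) (-ε⁻¹) r := by
      simpa using (((hasDerivAt_id r).sub_const R).const_mul ε⁻¹).const_sub 1
    refine hd.congr_of_eventuallyEq ?_
    filter_upwards [Ioo_mem_nhds h h'] with s hs
    have h3 : 0 ≤ ε⁻¹ * (s - R) := mul_nonneg (by positivity) (by linarith [hs.1])
    have h4 : ε⁻¹ * (s - R) ≤ 1 := by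
      rw [inv_mul_le_iff₀ hε]; linarith [hs.2]
    rw [cutoff, min_eq_right (by linarith), max_eq_right (by linarith)]
  · rw [indicator_of_notMem fun hr => h'.not_gt hr.2]
    refine (hasDerivAt_const r (0 : ℝ)).congr_of_eventuallyEq ?_
    filter_upwards [lt_mem_nhds h'] with s hs
    have h4 : 1 ≤ ε⁻¹ * (s - R) := by
      rw [le_inv_mul_iff₀ hε]; linarith
    rw [cutoff, max_eq_left ((min_le_right _ _).trans (by linarith))]

theorem tendsto_cutoff (R r : ℝ) :
    Tendsto (fun ε => cutoff R ε r) (𝓝[>] 0) (𝓝 (if r ≤ R then 1 else 0)) := by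
  split_ifs with h
  · refine tendsto_const_nhds.congr' ?_
    filter_upwards [self_mem_nhdsWithin] with ε hε
    have hε : 0 < ε := hε
    have : ε⁻¹ * (r - R) ≤ 0 := mul_nonpos_of_nonneg_of_nonpos (by positivity) (by linarith)
    rw [cutoff, min_eq_left (by linarith), max_eq_right zero_le_one]
  · refine tendsto_const_nhds.congr' ?_
    filter_upwards [Ioo_mem_nhdsGT (sub_pos.2 (not_le.1 h))] with ε hε
    have h4 : 1 ≤ ε⁻¹ * (r - R) := by
      rw [le_inv_mul_iff₀ hε.1]; linarith [hε.2]
    rw [cutoff, max_eq_left ((min_le_right _ _).trans (by linarith))]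

theorem abs_cutoff_le (R ε r : ℝ) : |cutoff R ε r| ≤ 1 := by
  rw [abs_of_nonneg (le_max_left _ _)]
  exact max_le zero_le_one (min_le_left _ _)

/-- The divergence theorem on a ball, for the vector field `ψ v`. -/
theorem integral_closedBall_fderiv (hn : 1 ≤ n) {R : ℝ} (hR : 0 < R)
    {ψ : EuclideanSpace ℝ (Fin n) → ℝ} (hψ : ContDiff ℝ ∞ ψ) (hψc : HasCompactSupport ψ)
    (v : EuclideanSpace ℝ (Fin n)) :
    ∫ x in closedBall 0 R, fderiv ℝ ψ x v =
      R ^ (n - 1) * ∫ θ : sphere (0 : EuclideanSpace ℝ (Fin n)) 1,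
        ψ (R • θ.1) * inner ℝ θ.1 v ∂(volume : Measure (EuclideanSpace ℝ (Fin n))).toSphere := by
  have : Nonempty (Fin n) := ⟨⟨0, hn⟩⟩
  have hdc : Continuous fun x => fderiv ℝ ψ x v :=
    (hψ.continuous_fderiv (by simp)).clm_apply continuous_const
  have hdi : Integrable fun x => fderiv ℝ ψ x v :=
    hdc.integrable_of_hasCompactSupport (hψc.fderiv_apply ℝ v)
  set m : ℝ → ℝ := fun r => r ^ (n - 1) * ∫ θ : sphere (0 : EuclideanSpace ℝ (Fin n)) 1,
    ψ (r • θ.1) * inner ℝ θ.1 v ∂(volume : Measure (EuclideanSpace ℝ (Fin n))).toSphere with hm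
  obtain ⟨C, hC⟩ := hψ.continuous.bounded_above_of_compact_support hψc
  have hmc : Continuous m := by
    refine (continuous_id.pow _).mul (continuous_of_dominated (bound := fun _ => C * ‖v‖)
      (fun r => ?_) (fun r => Eventually.of_forall fun θ => ?_) (integrable_const _)
      (Eventually.of_forall fun θ => ?_))
    · exact Continuous.aestronglyMeasurable ((hψ.continuous.comp (by fun_prop)).mul (by fun_prop))
    · rw [norm_mul]
      have h1 : ‖inner ℝ θ.1 v‖ ≤ ‖v‖ := by
        have := norm_inner_le_norm (𝕜 := ℝ) θ.1 v
        simpa using this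
      have h2 := hC (r • θ.1)
      exact mul_le_mul h2 h1 (norm_nonneg _) ((norm_nonneg _).trans h2)
    · exact (hψ.continuous.comp (by fun_prop)).mul continuous_const
  -- both sides are limits as `ε → 0` of the identity for the cutoffs
  have hlim1 : Tendsto (fun ε : ℝ => ∫ x, cutoff R ε ‖x‖ * fderiv ℝ ψ x v) (𝓝[>] 0)
      (𝓝 (∫ x in closedBall 0 R, fderiv ℝ ψ x v)) := by
    rw [← integral_indicator measurableSet_closedBall]
    refine tendsto_integral_filter_of_dominated_convergence (fun x => ‖fderiv ℝ ψ x v‖) ?_ ?_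
      hdi.norm ?_
    · refine Eventually.of_forall fun ε => ?_
      obtain ⟨K, hK⟩ := lipschitzWith_cutoff R ε
      exact ((hK.continuous.comp continuous_norm).mul hdc).aestronglyMeasurable
    · refine Eventually.of_forall fun ε => Eventually.of_forall fun x => ?_
      rw [norm_mul]
      exact mul_le_of_le_one_left (norm_nonneg _) (abs_cutoff_le _ _ _)
    · refine Eventually.of_forall fun x => ?_
      have := (tendsto_cutoff R ‖x‖).mul_const (fderiv ℝ ψ x v)
      convert this using 2
      simp [indicator]
  have hlim2 : Tendsto (fun ε : ℝ => ε⁻¹ * ∫ r in R..R + ε, m r) (𝓝[>] 0) (𝓝 (m R)) := by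
    have h1 := (hmc.integral_hasStrictDerivAt R R).hasDerivAt.tendsto_slope_zero_right
    simpa using h1
  refine tendsto_nhds_unique hlim1 (hlim2.congr' ?_)
  filter_upwards [self_mem_nhdsWithin] with ε hε
  have hε : 0 < ε := hε
  obtain ⟨K, hK⟩ := lipschitzWith_cutoff R ε
  rw [integral_comp_norm_mul_fderiv hn hK R (R + ε)
    (fun r _ h1 h2 => hasDerivAt_cutoff hε h1 h2) hψ hψc v, ← integral_neg,
    integral_eq_integral_radius_integral_sphere, finrank_euclideanSpace_fin,
    intervalIntegral.integral_of_le (by linarith), integral_Ioc_eq_integral_Ioo,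
    ← integral_const_mul, eq_comm]
  · rw [setIntegral_eq_of_subset_of_forall_sdiff_eq_zero (s := Ioo R (R + ε)) measurableSet_Ioi
      fun r hr => hR.trans hr.1]
    · refine setIntegral_congr_fun measurableSet_Ioo fun r hr => ?_
      have hr0 : 0 < r := hR.trans hr.1
      simp only [hm]
      rw [mul_left_comm, ← integral_const_mul ε⁻¹]
      congr 1
      refine integral_congr_ae (Eventually.of_forall fun θ => ?_)
      simp only
      have hnorm : ‖r • θ.1‖ = r := by
        rw [norm_smul, Real.norm_of_nonneg hr0.le]; simp
      rw [hnorm, indicator_of_mem hr, inner_smul_left]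
      simp only [conj_trivial]
      field_simp
    · intro r hr
      have hr0 : 0 < r := hr.1
      have : ∀ θ : sphere (0 : EuclideanSpace ℝ (Fin n)) 1, ‖r • θ.1‖ = r := fun θ => by
        rw [norm_smul, Real.norm_of_nonneg hr0.le]; simp
      simp [this, indicator_of_notMem hr.2]
  · refine Integrable.neg ?_
    refine Integrable.mul_bdd (c := ε⁻¹ * ‖v‖)
      (hψ.continuous.integrable_of_hasCompactSupport hψc) ?_ (Eventually.of_forall fun x => ?_)
    · refine Measurable.aestronglyMeasurable (Measurable.mul ?_ ?_)
      · exact (measurable_const.indicator measurableSet_Ioo).comp measurable_norm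
      · exact Measurable.div (Continuous.measurable (by fun_prop)) measurable_norm
    · rw [norm_mul, norm_div, norm_norm]
      refine mul_le_mul ?_ ?_ (by positivity) (by positivity)
      · rw [Real.norm_eq_abs]
        unfold indicator
        split_ifs
        · rw [abs_neg, abs_of_pos (by positivity)]
        · simp; positivity
      · exact div_le_of_le_mul₀ (norm_nonneg _) (norm_nonneg _)
          ((norm_inner_le_norm _ _).trans_eq (mul_comm _ _))

end

section
variable {n : ℕ} {β R : ℝ}

/-- The radial profile of the Lipschitz part of `u`: the function `u - δ 1_{|x| ≤ R}`. -/
def lipProfile (n : ℕ) (β R r : ℝ) : ℝ :=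
  slopeConst n β R * (Gam n R - Gam n (min (max r 1) R))

theorem lipschitzWith_lipProfile (hn : 1 ≤ n) (hR : 1 ≤ R) :
    ∃ K, LipschitzWith K (lipProfile n β R) := by
  have h1 : LipschitzOnWith 1 (Gam n) (Icc 1 R) := by
    refine (convex_Icc _ _).lipschitzOnWith_of_nnnorm_hasDerivWithin_le
      (fun r hr => (hasDerivAt_Gam hn (one_pos.trans_le hr.1)).hasDerivWithinAt) fun r hr => ?_
    have h0 := one_pos.trans_le hr.1
    rw [← NNReal.coe_le_coe, coe_nnnorm, Real.norm_of_nonneg (by positivity)]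
    exact (div_le_one (by positivity)).2 (one_le_pow₀ hr.1)
  have h2 : LipschitzWith 1 fun r : ℝ => min (max r 1) R :=
    (LipschitzWith.id.max_const 1).min_const R
  have h3 : LipschitzWith (1 * 1) fun r : ℝ => Gam n (min (max r 1) R) := by
    rw [← lipschitzOnWith_univ]
    exact h1.comp h2.lipschitzOnWith fun r _ => ⟨le_min (le_max_right _ _) hR, min_le_right _ _⟩
  have h4 : LipschitzWith ‖slopeConst n β R‖₊ fun r : ℝ => slopeConst n β R * r :=
    LipschitzWith.of_dist_le_mul fun x y => by
      rw [Real.dist_eq, Real.dist_eq, ← mul_sub, abs_mul]; rfl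
  exact ⟨_, h4.comp ((LipschitzWith.const (Gam n R)).sub h3)⟩

theorem hasDerivAt_lipProfile (hn : 1 ≤ n) (hR : 1 ≤ R) {r : ℝ} (h1 : r ≠ 1) (h2 : r ≠ R) :
    HasDerivAt (lipProfile n β R)
      ((Ioo 1 R).indicator (fun r => -(slopeConst n β R / r ^ (n - 1))) r) r := by
  rcases lt_or_gt_of_ne h1 with h | h
  · rw [indicator_of_notMem fun hr => h.not_gt hr.1]
    refine (hasDerivAt_const r (lipProfile n β R 1)).congr_of_eventuallyEq ?_
    filter_upwards [gt_mem_nhds h] with s hs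
    simp [lipProfile, max_eq_right (le_of_lt hs)]
  rcases lt_or_gt_of_ne h2 with h' | h'
  · rw [indicator_of_mem (show r ∈ Ioo 1 R from ⟨h, h'⟩)]
    have hd := ((hasDerivAt_Gam hn (one_pos.trans h)).const_sub (Gam n R)).const_mul
      (slopeConst n β R)
    refine (hd.congr_deriv (by ring)).congr_of_eventuallyEq ?_
    filter_upwards [Ioo_mem_nhds h h'] with s hs
    simp [lipProfile, max_eq_left hs.1.le, min_eq_left hs.2.le]
  · rw [indicator_of_notMem fun hr => h'.not_gt hr.2]
    refine (hasDerivAt_const r (lipProfile n β R R)).congr_of_eventuallyEq ?_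
    filter_upwards [lt_mem_nhds h'] with s hs
    have hs1 : 1 ≤ s := hR.trans (le_of_lt hs)
    simp [lipProfile, max_eq_left hs1, min_eq_right (le_of_lt hs), max_eq_left hR]

theorem radialU_eq_lipProfile_add (hn : 1 ≤ n) (hβ : 0 < β) (hR : 1 ≤ R)
    (x : EuclideanSpace ℝ (Fin n)) :
    radialU n β R x =
      lipProfile n β R ‖x‖ + (closedBall 0 R).indicator (fun _ => delta n β R) x := by
  have hc := one_sub_slopeConst_mul_Gam hn hβ hR
  rw [radialU_eq hR, lipProfile]
  by_cases h : ‖x‖ ≤ R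
  · rw [if_pos h, indicator_of_mem (by simpa using h), min_eq_left (max_le h hR), ← hc, radius]
    ring
  · have h1 : 1 ≤ ‖x‖ := hR.trans (not_le.1 h).le
    rw [if_neg h, indicator_of_notMem (by simpa using h), max_eq_left h1,
      min_eq_right (not_le.1 h).le]
    ring

theorem hasCompactSupport_radialU (hR : 1 ≤ R) : HasCompactSupport (radialU n β R) := by
  refine HasCompactSupport.intro (isCompact_closedBall 0 R) fun x hx => ?_
  rw [radialU_eq hR, if_neg (by simpa using hx)]

theorem measurable_gradU : Measurable (gradU (n := n) β R) := by
  refine Measurable.ite ((measurableSet_lt measurable_const measurable_norm).inter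
    (measurableSet_lt measurable_norm measurable_const)) ?_ measurable_const
  exact ((measurable_const.div (measurable_norm.pow_const n)).neg).smul measurable_id

theorem norm_gradU_le (hn : 1 ≤ n) (hβ : 0 < β) (hR : 1 ≤ R) (x : EuclideanSpace ℝ (Fin n)) :
    ‖gradU β R x‖ ≤ slopeConst n β R := by
  have hc := slopeConst_pos hn hβ hR
  unfold gradU
  split_ifs with h
  · have h0 : 0 < ‖x‖ := one_pos.trans h.1
    have hp : ‖x‖ ^ n = ‖x‖ * ‖x‖ ^ (n - 1) := by rw [← pow_succ']; congr 1; omega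
    rw [norm_smul, norm_neg, Real.norm_of_nonneg (by positivity), hp]
    have : slopeConst n β R / (‖x‖ * ‖x‖ ^ (n - 1)) * ‖x‖ = slopeConst n β R / ‖x‖ ^ (n - 1) := by
      field_simp
    rw [this]
    exact div_le_self hc.le (one_le_pow₀ h.1.le)
  · simpa using hc.le

theorem integrable_of_bounded_of_eq_zero {V : Type*} [NormedAddCommGroup V] [MeasurableSpace V]
    [BorelSpace V] [SecondCountableTopology V]
    {f : EuclideanSpace ℝ (Fin n) → V} (hf : Measurable f) {C : ℝ} (hC : ∀ x, ‖f x‖ ≤ C)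
    (h0 : ∀ x, R < ‖x‖ → f x = 0) : Integrable f := by
  have h1 : IntegrableOn f (closedBall 0 R) :=
    IntegrableOn.of_bound measure_closedBall_lt_top hf.aestronglyMeasurable C
      (Eventually.of_forall hC)
  refine h1.integrable_of_forall_notMem_eq_zero fun x hx => h0 x ?_
  simpa using hx

theorem integrable_radialU (hn : 1 ≤ n) (hβ : 0 < β) (hR : 1 ≤ R) :
    Integrable (radialU n β R) :=
  integrable_of_bounded_of_eq_zero (R := R) (measurable_radialU hR) (abs_radialU_le hn hβ hR)
    fun x hx => by rw [radialU_eq hR, if_neg hx.not_ge]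

theorem integrable_gradU (hn : 1 ≤ n) (hβ : 0 < β) (hR : 1 ≤ R) :
    Integrable (gradU (n := n) β R) :=
  integrable_of_bounded_of_eq_zero (R := R) measurable_gradU (norm_gradU_le hn hβ hR)
    fun x hx => by simp [gradU, hx.not_gt]

/-- The distributional derivative of `u`: the singular part is carried by the sphere `|x| = R`. -/
theorem isSBVWithGradient_radialU (hn : 1 ≤ n) (hβ : 0 < β) (hR : 1 ≤ R) :
    IsSBVWithGradient (radialU n β R) (gradU β R) := by
  have : Nonempty (Fin n) := ⟨⟨0, hn⟩⟩
  have hR0 : 0 < R := by linarith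
  have hnorm : ∀ θ : sphere (0 : EuclideanSpace ℝ (Fin n)) 1, ‖R • θ.1‖ = R := fun θ => by
    rw [norm_smul, Real.norm_of_nonneg hR0.le]; simp
  have hj : Continuous fun θ : sphere (0 : EuclideanSpace ℝ (Fin n)) 1 => R • θ.1 := by fun_prop
  have hs : Continuous fun x : EuclideanSpace ℝ (Fin n) =>
    -(delta n β R * R ^ (n - 1) * R⁻¹) • x := by fun_prop
  refine ⟨integrable_radialU hn hβ hR, integrable_gradU hn hβ hR,
    -- the factor `R^{n-1}` of surface measure is put into the density, and `R⁻¹ x` is the normal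
    (volume : Measure (EuclideanSpace ℝ (Fin n))).toSphere.map fun θ => R • θ.1,
    fun x => -(delta n β R * R ^ (n - 1) * R⁻¹) • x, inferInstance, ?_, ?_, ?_⟩
  · rw [integrable_map_measure hs.aestronglyMeasurable hj.measurable.aemeasurable]
    refine Integrable.of_bound (hs.comp hj).aestronglyMeasurable
      (‖-(delta n β R * R ^ (n - 1) * R⁻¹)‖ * R) (Eventually.of_forall fun θ => ?_)
    rw [Function.comp_apply, norm_smul, hnorm]
  · have hsub : (jumpSet (radialU n β R))ᶜ ⊆ (sphere (0 : EuclideanSpace ℝ (Fin n)) R)ᶜ :=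
      compl_subset_compl.2 fun x hx =>
        ⟨_, _, _, isJump_radialU hn hβ hR (by simpa using hx)⟩
    refine measure_mono_null hsub ?_
    rw [Measure.map_apply hj.measurable isClosed_sphere.measurableSet.compl]
    convert measure_empty (μ := (volume : Measure (EuclideanSpace ℝ (Fin n))).toSphere)
    ext θ
    simp [hnorm]
  · intro ψ hψ hψc v
    have hdc : Continuous fun x => fderiv ℝ ψ x v :=
      (hψ.continuous_fderiv (by simp)).clm_apply continuous_const
    have hdi : Integrable fun x => fderiv ℝ ψ x v :=
      hdc.integrable_of_hasCompactSupport (hψc.fderiv_apply ℝ v)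
    obtain ⟨K, hK⟩ := lipschitzWith_lipProfile (n := n) (β := β) hn hR
    have hLc : Continuous fun x : EuclideanSpace ℝ (Fin n) =>
        lipProfile n β R ‖x‖ * fderiv ℝ ψ x v := (hK.continuous.comp continuous_norm).mul hdc
    have hLi : Integrable fun x : EuclideanSpace ℝ (Fin n) =>
        lipProfile n β R ‖x‖ * fderiv ℝ ψ x v := hLc.integrable_of_hasCompactSupport (hψc.fderiv_apply ℝ v).mul_left
    have hsc : Continuous fun x =>
        ψ x * inner ℝ (-(delta n β R * R ^ (n - 1) * R⁻¹) • x) v :=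
      hψ.continuous.mul (by fun_prop)
    have hsurf : ∫ x, ψ x * inner ℝ (-(delta n β R * R ^ (n - 1) * R⁻¹) • x) v
        ∂((volume : Measure (EuclideanSpace ℝ (Fin n))).toSphere.map fun θ => R • θ.1) =
        -(delta n β R * ∫ x in closedBall 0 R, fderiv ℝ ψ x v) := by
      rw [integral_map hj.measurable.aemeasurable
        hsc.aestronglyMeasurable,
        integral_closedBall_fderiv hn hR0 hψ hψc v, ← mul_assoc, ← integral_const_mul, ← integral_neg]
      congr 1; ext θ
      rw [smul_smul, inner_smul_left]
      simp only [conj_trivial]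
      field_simp
    have hgrad : ∫ x, lipProfile n β R ‖x‖ * fderiv ℝ ψ x v =
        -∫ x, ψ x * inner ℝ (gradU β R x) v := by
      rw [integral_comp_norm_mul_fderiv hn hK 1 R
        (fun r _ h1 h2 => hasDerivAt_lipProfile hn hR h1 h2) hψ hψc v]
      congr 2; ext x
      congr 1
      by_cases h : 1 < ‖x‖ ∧ ‖x‖ < R
      · have h0 : 0 < ‖x‖ := one_pos.trans h.1
        have hp : ‖x‖ ^ n = ‖x‖ * ‖x‖ ^ (n - 1) := by rw [← pow_succ']; congr 1; omega
        rw [indicator_of_mem (show ‖x‖ ∈ Ioo 1 R from h), gradU, if_pos h, inner_smul_left, hp]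
        simp only [conj_trivial]
        field_simp
      · rw [indicator_of_notMem (show ‖x‖ ∉ Ioo 1 R from h), gradU, if_neg h]
        simp
    rw [hsurf, neg_add, neg_neg, ← hgrad, ← integral_indicator measurableSet_closedBall,
      ← integral_const_mul, ← integral_add hLi ((hdi.indicator measurableSet_closedBall).const_mul _)]
    congr 1; ext x
    rw [radialU_eq_lipProfile_add hn hβ hR, add_mul]
    congr 1
    by_cases h : x ∈ closedBall (0 : EuclideanSpace ℝ (Fin n)) R
    · simp only [indicator_of_mem h]
    · simp only [indicator_of_notMem h, zero_mul, mul_zero]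

end

end ThermalInsulation

end

theorem theorem3p3 (n : ℕ) (hn : 1 ≤ n) (β γ R : ℝ) (hγ : 0 < γ)
    (hβ : (n : ℝ) - 1 / 2 ≤ β) (hR : 1 ≤ R)
    (hEL : (β ^ 2 - β * ((n : ℝ) - 1) / R) * ThermalInsulation.delta n β R ^ 2 = γ ^ 2) :
    ThermalInsulation.IsCalibrated (Metric.ball (0 : EuclideanSpace ℝ (Fin n)) 1) β γ
      (ThermalInsulation.radialU n β R) := by
  have hn' : (1 : ℝ) ≤ n := by exact_mod_cast hn
  have hβ0 : 0 < β := by linarith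
  have hout : ∀ x : EuclideanSpace ℝ (Fin n), x ∉ Metric.ball 0 1 → 1 ≤ ‖x‖ := fun x hx => by
    simpa using hx
  have hcl : ∀ x : EuclideanSpace ℝ (Fin n), x ∉ closure (Metric.ball 0 1) → 1 < ‖x‖ :=
    fun x hx => by
      rw [closure_ball _ one_ne_zero] at hx
      simpa using hx
  refine ⟨fun x hx => ?_, ThermalInsulation.radialU_mem_Icc hn hβ0 hR,
    ThermalInsulation.hasCompactSupport_radialU hR, ThermalInsulation.gradU β R,
    ThermalInsulation.isSBVWithGradient_radialU hn hβ0 hR, ThermalInsulation.calib β γ R, ?_⟩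
  · have hx1 : ‖x‖ < 1 := by simpa using hx
    rw [ThermalInsulation.radialU, if_pos hx1.le]
  · refine ⟨(ThermalInsulation.measurable_calib hn hβ0 hR).comp measurable_subtype_coe,
      ThermalInsulation.isBoundedApproxRegular_calib hn hβ0 hR,
      ThermalInsulation.isDivFree_calib hn hβ0 hR, Eventually.of_forall fun x hx t ht => ?_,
      Eventually.of_forall fun x hx r s hrs => ⟨?_, ?_⟩, ?_,
      Eventually.of_forall fun x a b ν hj => ?_⟩
    · exact ThermalInsulation.le_calib_snd hn hβ hR hEL (hcl x hx).le ht
    · exact ThermalInsulation.intervalIntegrable_calib_fst hn hβ0 hR x r s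
    · exact ThermalInsulation.norm_integral_calib_fst_le hn hβ hR hEL (hout x hx) hrs
    · filter_upwards [ThermalInsulation.ae_norm_ne hn R] with x hxR hx
      exact ThermalInsulation.calib_apply_radialU hn hβ hR hEL (hcl x hx) hxR
    · obtain ⟨hxR, rfl, rfl, rfl⟩ := hj.radialU_eq hn hβ0 hR
      exact ThermalInsulation.integral_calib_fst_of_norm_eq hn hβ0 hR hxR
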